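/- Let $n\ge 1$ and let $v_0,\dots,v_{2n-1}$ be the vertices of a convex polygon $\mathcal P$ in the plane (no three of them collinear), labelled in counterclockwise order with indices modulo $2n$; $n$ of the points are coloured red and $n$ blue. A *matching* $M$ is a perfect matching of red points with blue points by pairwise disjoint straight line segments; its value $\mathrm{bn}(M)$ is the length of its longest segment, and a *bottleneck matching* is a matching of minimum value. A pair $(i,j)$ is *feasible* if some matching contains it; $o(i)$ is the first point after $i$ in the counterclockwise direction such that $(i,o(i))$ is feasible; a feasible pair $(i,j)$ is an *edge* if $i=o(j)$ or $j=o(i)$, and a *diagonal* otherwise. The *turning angle* $\tau(i,j)\in[0,2\pi)$ is the angle by which the vector $\overrightarrow{v_iv_{i+1}}$ has to be rotated counterclockwise to align with $\overrightarrow{v_{j-1}v_j}$. The diagonals (not the edges) of a matching $M$ cut the interior of $\mathcal P$ into *regions*; a region is *$k$-bounded* if exactly $k$ diagonals of $M$ lie on its boundary. A *cascade* of $M$ is a maximal set of diagonals of $M$ connected through $2$-bounded regions, i.e. an equivalence class of the equivalence relation on the diagonals of $M$ generated by "bounding a common $2$-bounded region". Then there is a bottleneck matching $M$ such that every diagonal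 of $M$, in either orientation $(i,j)$, satisfies $\tau(i,j)>\pi/2$, and such that $M$ has at most three cascades. More precisely, for this $M$ one of the following holds: (a) $M$ has at most one cascade, and every region is bounded by at most two diagonals of $M$; or (b) $M$ has exactly three cascades, there is exactly one region bounded by more than two diagonals, this region is $3$-bounded, and each of the three cascades contains exactly one of the three diagonals bounding it. -/

import Mathlib

noncomputable section

namespace Bichromatic

/-- The points `v 0, …, v (N - 1)` of the plane (identified with `ℂ`), indexed cyclically, are the
vertices of a convex polygon, labelled in positive (counterclockwise) direction: whenever `i`, `j`,
`k` are distinct and are met in this order when going around in the positive direction, the triangle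
`v i, v j, v k` is positively oriented. (Injectivity only matters for `N = 2`.) -/
structure IsConvexPolygon {N : ℕ} (v : ZMod N → ℂ) : Prop where
  injective : Function.Injective v
  ccw : ∀ i j k : ZMod N, 0 < (j - i).val → (j - i).val < (k - i).val →
    0 < (v j - v i).re * (v k - v i).im - (v j - v i).im * (v k - v i).re

/-- The colouring `c` (`true` is red, `false` is blue) has `n` red and `n` blue points. -/
def IsBalanced {n : ℕ} (c : ZMod (2 * n) → Bool) : Prop :=
  {i | c i = true}.ncard = n ∧ {i | c i = false}.ncard = n

/-- A perfect crossing-free bichromatic matching of the points `v i` with colours `c i`: every point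
is joined by a line segment to one partner of the other colour, and the segments of distinct pairs
are disjoint. -/
structure Matching {N : ℕ} (v : ZMod N → ℂ) (c : ZMod N → Bool) where
  partner : ZMod N → ZMod N
  partner_partner : ∀ i, partner (partner i) = i
  color_partner_ne : ∀ i, c (partner i) ≠ c i
  disjoint_segments : ∀ i j, j ≠ i → j ≠ partner i →
    Disjoint (segment ℝ (v i) (v (partner i))) (segment ℝ (v j) (v (partner j)))

variable {N : ℕ} (v : ZMod N → ℂ) (c : ZMod N → Bool)

/-- A pair is feasible if some matching contains it. -/
def Feasible (i j : ZMod N) : Prop := ∃ M : Matching v c, M.partner i = j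

/-- The function `o`: `o i` is the first point, going from `i` in the positive direction, that forms
a feasible pair with `i`. -/
def o (i : ZMod N) : ZMod N := i + ((sInf {k : ℕ | Feasible v c i (i + (k : ZMod N))} : ℕ) : ZMod N)

/-- A feasible pair is an edge if one of its points is the image of the other one under `o`. -/
def IsEdge (i j : ZMod N) : Prop := Feasible v c i j ∧ (i = o v c j ∨ j = o v c i)

/-- The feasible pairs that are not edges are the diagonals. -/
def IsDiagonal (i j : ZMod N) : Prop := Feasible v c i j ∧ ¬ IsEdge v c i j

/-- The turning angle `τ(i, j) ∈ [0, 2π)`: the angle by which the vector from `v i` to `v (i + 1)`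
has to be rotated in the positive direction to align with the vector from `v (j - 1)` to `v j`. -/
def turningAngle (i j : ZMod N) : ℝ :=
  toIcoMod Real.two_pi_pos 0 (Complex.arg ((v j - v (j - 1)) / (v (i + 1) - v i)))

/-- The line segment spanned by an unordered pair of points. -/
def seg (e : Sym2 (ZMod N)) : Set ℂ :=
  Sym2.lift ⟨fun i j => segment ℝ (v i) (v j), fun i j => segment_symm ℝ (v i) (v j)⟩ e

namespace Matching

variable {v c} (M : Matching v c)

/-- The value of a matching: the length of a longest segment. -/
def bn : ℝ := ⨆ i, dist (v i) (v (M.partner i))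

/-- A bottleneck matching is a matching of least value. -/
def IsBottleneck : Prop := ∀ M' : Matching v c, M.bn ≤ M'.bn

/-- The diagonals belonging to a matching, as unordered pairs. -/
def diagonals : Set (Sym2 (ZMod N)) :=
  {e | ∃ i, IsDiagonal v c i (M.partner i) ∧ e = s(i, M.partner i)}

/-- The interior of the polygon, cut along all diagonals (not edges) of the matching. -/
def cutInterior : Set ℂ :=
  interior (convexHull ℝ (Set.range v)) \ ⋃ e ∈ M.diagonals, seg v e

/-- The regions: the connected components of the cut interior of the polygon. -/
def regions : Set (Set ℂ) :=
  {R | ∃ x ∈ M.cutInterior, R = connectedComponentIn M.cutInterior x}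

/-- The diagonals of the matching that bound the region `R`. -/
def boundingDiagonals (R : Set ℂ) : Set (Sym2 (ZMod N)) :=
  {e | e ∈ M.diagonals ∧ seg v e ⊆ frontier R}

/-- `R` is a `k`-bounded region: a region bounded by exactly `k` diagonals of the matching. -/
def IsKBounded (k : ℕ) (R : Set ℂ) : Prop :=
  R ∈ M.regions ∧ (M.boundingDiagonals R).ncard = k

/-- Two diagonals of the matching bound a common `2`-bounded region. -/
def Linked (d e : Sym2 (ZMod N)) : Prop :=
  ∃ R, M.IsKBounded 2 R ∧ d ∈ M.boundingDiagonals R ∧ e ∈ M.boundingDiagonals R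

/-- The cascades: the maximal families of diagonals of the matching that are connected by
`2`-bounded regions, i.e. the classes of the equivalence relation that `Linked` generates on the
diagonals of the matching. -/
def cascades : Set (Set (Sym2 (ZMod N))) :=
  {C | ∃ d ∈ M.diagonals, C = {e | e ∈ M.diagonals ∧ Relation.ReflTransGen M.Linked d e}}

end Matching

end Bichromatic

end

/-! The proof combines a local exchange, an angle count and a purely combinatorial argument on
non-crossing chords.

Exchange: if the turning angle of a pair `(i, j)` of a matching is at most `π / 2`, any two sides on
the arc from `i` to `j` enclose an angle of at most `π / 2`, so no chord of that arc is longer than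
the chord from `i` to `j` (`dist_le_of_turningAngle_le`). The points of the arc are matched among
themselves, hence balanced, and can be rematched inside the arc by joining points to the first point
that closes a balanced interval; all these new pairs are edges (`exists_linearMatching`,
`Matching.exists_replace`). This does not increase the value and destroys a diagonal, so a
bottleneck matching with as few diagonals as possible has only diagonals of large turning angle.

Angle count: the directions of the sides increase and stay within one full turn, and a turning angle
is a difference of two directions. So four disjoint arcs cannot all turn by more than `π / 2`
(`not_four_arcs`), and no four diagonals cut off pairwise disjoint arcs.

Combinatorics: `ChordSystem` retains only which chord or region lies on which side of which chord.
Four diagonals around one region would cut off four disjoint arcs; so would two diagonals from each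
of two regions with three bounding diagonals. Hence at most one region has more than two bounding
diagonals, and it has exactly three. The walk from a diagonal to a fixed such region (or to any
region, if there is none) crosses only 2-bounded regions, so every cascade reaches the diagonals
around it. A 3-bounded region keeps its three diagonals in different cascades, as links cannot pass
from one pocket to another (`cascades_dichotomy`). Finally, regions are identified with convex
cells, cut out by sign conditions, to see that the geometry is an instance (`boundingDiagonals_eq`,
`chordSystem`). -/

set_option linter.unusedSectionVars false

noncomputable section

namespace Bichromatic

/-! ### Orientation of triples and chords of a convex polygon -/

/-- Twice the signed area of the triangle `a`, `b`, `c`. -/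
def cr (a b c : ℂ) : ℝ := (b - a).re * (c - a).im - (b - a).im * (c - a).re

lemma cr_rotate (a b c : ℂ) : cr b c a = cr a b c := by
  simp only [cr, Complex.sub_re, Complex.sub_im]; ring

lemma cr_swap (a b c : ℂ) : cr b a c = -cr a b c := by
  simp only [cr, Complex.sub_re, Complex.sub_im]; ring

lemma cr_swap_right (a b c : ℂ) : cr a c b = -cr a b c := by
  simp only [cr, Complex.sub_re, Complex.sub_im]; ring

@[simp] lemma cr_left (a b : ℂ) : cr a b a = 0 := by
  simp [cr]

@[simp] lemma cr_right (a b : ℂ) : cr a b b = 0 := by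
  simp only [cr]; ring

lemma cr_comb (a b x y : ℂ) {s t : ℝ} (h : s + t = 1) :
    cr a b (s • x + t • y) = s * cr a b x + t * cr a b y := by
  obtain rfl : s = 1 - t := by linarith
  simp only [cr, Complex.sub_re, Complex.sub_im, Complex.add_re, Complex.add_im,
    Complex.real_smul, Complex.re_ofReal_mul, Complex.im_ofReal_mul]
  ring

lemma continuous_cr (a b : ℂ) : Continuous (cr a b) := by
  unfold cr; fun_prop

lemma convex_cr_nonneg (a b : ℂ) : Convex ℝ {x | 0 ≤ cr a b x} := by
  intro x hx y hy s t hs ht hst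
  simp only [Set.mem_ofPred_eq] at *
  rw [cr_comb _ _ _ _ hst]; positivity

lemma convex_cr_pos (a b : ℂ) : Convex ℝ {x | 0 < cr a b x} := by
  intro x hx y hy s t hs ht hst
  simp only [Set.mem_ofPred_eq] at *
  rw [cr_comb _ _ _ _ hst]
  rcases hs.eq_or_lt with rfl | hs
  · simpa [show t = 1 by linarith] using hy
  · have := mul_pos hs hx
    have := mul_nonneg ht hy.le
    linarith

lemma convex_cr_neg (a b : ℂ) : Convex ℝ {x | cr a b x < 0} := by
  convert convex_cr_pos b a using 2
  ext x
  rw [cr_swap a b x]; simp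

lemma cr_eq_zero_of_mem_segment {a b x : ℂ} (h : x ∈ segment ℝ a b) : cr a b x = 0 := by
  obtain ⟨s, t, -, -, hst, rfl⟩ := h
  rw [cr_comb _ _ _ _ hst]; simp

lemma disjoint_segment_of_pos {a b c d : ℂ} (hc : 0 < cr a b c) (hd : 0 < cr a b d) :
    Disjoint (segment ℝ a b) (segment ℝ c d) := by
  rw [Set.disjoint_left]
  intro x hx hx'
  have h := (convex_cr_pos a b).segment_subset hc hd hx'
  simp [cr_eq_zero_of_mem_segment hx] at h

lemma disjoint_segment_of_neg {a b c d : ℂ} (hc : cr a b c < 0) (hd : cr a b d < 0) :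
    Disjoint (segment ℝ a b) (segment ℝ c d) := by
  rw [Set.disjoint_left]
  intro x hx hx'
  have h := (convex_cr_neg a b).segment_subset hc hd hx'
  simp [cr_eq_zero_of_mem_segment hx] at h

/-- The two diagonals of a convex quadrilateral `a`, `b`, `c`, `d` cross. -/
lemma not_disjoint_diagonals {a b c d : ℂ} (habc : 0 < cr a b c) (habd : 0 < cr a b d)
    (hacd : 0 < cr a c d) (hbcd : 0 < cr b c d) :
    ¬ Disjoint (segment ℝ a c) (segment ℝ b d) := by
  rw [Set.not_disjoint_iff]
  -- Both sums are twice the area of the quadrilateral. The crossing point divides each diagonal in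
  -- the ratio of the triangles that the other diagonal cuts off, which gives the weights below.
  have hsum : cr b c d + cr a b d = cr a c d + cr a b c := by
    simp only [cr, Complex.sub_re, Complex.sub_im]; ring
  have hpos : 0 < cr b c d + cr a b d := by positivity
  refine ⟨(cr b c d / (cr b c d + cr a b d)) • a + (cr a b d / (cr b c d + cr a b d)) • c,
    ⟨_, _, by positivity, by positivity, by field_simp, rfl⟩,
    ⟨cr a c d / (cr b c d + cr a b d), cr a b c / (cr b c d + cr a b d),
      by positivity, by positivity, by rw [hsum] at hpos ⊢; field_simp, ?_⟩⟩
  have hne := hpos.ne'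
  apply Complex.ext
  all_goals
    simp only [Complex.add_re, Complex.add_im, Complex.real_smul, Complex.re_ofReal_mul,
      Complex.im_ofReal_mul]
    field_simp
    simp only [cr, Complex.sub_re, Complex.sub_im]
    ring

section Polygon

variable {N : ℕ} [NeZero N] {v : ZMod N → ℂ}

lemma add_val_sub (i x : ZMod N) : i + ((x - i).val : ZMod N) = x := by simp

lemma val_add_sub (i : ZMod N) {a : ℕ} (ha : a < N) : (i + (a : ZMod N) - i).val = a := by
  simp [ZMod.val_natCast_of_lt ha]

lemma val_pos_of_ne {x i : ZMod N} (h : x ≠ i) : 0 < (x - i).val := by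
  rw [Nat.pos_iff_ne_zero, Ne, ZMod.val_eq_zero, sub_eq_zero]; exact h

lemma val_sub_inj {i x y : ZMod N} (h : (x - i).val = (y - i).val) : x = y := by
  rw [← add_val_sub i x, h, add_val_sub]

lemma cr_pos (hv : IsConvexPolygon v) (b : ZMod N) {r s t : ℕ} (hrs : r < s) (hst : s < t)
    (ht : t < N) :
    0 < cr (v (b + (r : ZMod N))) (v (b + (s : ZMod N))) (v (b + (t : ZMod N))) := by
  have h1 : (b + (s : ZMod N) - (b + (r : ZMod N))).val = s - r := by
    rw [add_sub_add_left_eq_sub, ← Nat.cast_sub hrs.le, ZMod.val_natCast_of_lt (by omega)]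
  have h2 : (b + (t : ZMod N) - (b + (r : ZMod N))).val = t - r := by
    rw [add_sub_add_left_eq_sub, ← Nat.cast_sub (by omega), ZMod.val_natCast_of_lt (by omega)]
  exact hv.ccw _ _ _ (by omega) (by omega)

lemma cr_pos_of_val (hv : IsConvexPolygon v) {b x y z : ZMod N}
    (h1 : (x - b).val < (y - b).val) (h2 : (y - b).val < (z - b).val) :
    0 < cr (v x) (v y) (v z) := by
  have := cr_pos hv b h1 h2 (ZMod.val_lt _)
  rwa [add_val_sub, add_val_sub, add_val_sub] at this

/-- Vertices on the arc from `i` to `j` are on the right of the chord from `i` to `j`. -/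
lemma cr_neg_of_val_lt (hv : IsConvexPolygon v) {i j x : ZMod N} (hx : x ≠ i)
    (h : (x - i).val < (j - i).val) : cr (v i) (v j) (v x) < 0 := by
  have := cr_pos hv i (r := 0) (s := (x - i).val) (t := (j - i).val) (val_pos_of_ne hx) h
    (ZMod.val_lt _)
  rw [add_val_sub, add_val_sub, Nat.cast_zero, add_zero] at this
  rw [cr_swap_right]; linarith

/-- Vertices outside of the arc from `i` to `j` are on the left of the chord from `i` to `j`. -/
lemma cr_pos_of_lt_val (hv : IsConvexPolygon v) {i j x : ZMod N} (hj : j ≠ i)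
    (h : (j - i).val < (x - i).val) : 0 < cr (v i) (v j) (v x) := by
  have := cr_pos hv i (r := 0) (s := (j - i).val) (t := (x - i).val) (val_pos_of_ne hj) h
    (ZMod.val_lt _)
  rwa [add_val_sub, add_val_sub, Nat.cast_zero, add_zero] at this

lemma cr_ne_zero (hv : IsConvexPolygon v) {i j x : ZMod N} (hj : j ≠ i) (hxi : x ≠ i)
    (hxj : x ≠ j) : cr (v i) (v j) (v x) ≠ 0 := by
  rcases lt_trichotomy (x - i).val (j - i).val with h | h | h
  · exact (cr_neg_of_val_lt hv hxi h).ne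
  · exact absurd (val_sub_inj h) hxj
  · exact (cr_pos_of_lt_val hv hj h).ne'

end Polygon

/-! ### Arguments in `[0, 2π)` -/

/-- The argument of a complex number, taken in `[0, 2π)`. -/
def argPos (z : ℂ) : ℝ := toIcoMod Real.two_pi_pos 0 (Complex.arg z)

lemma argPos_nonneg (z : ℂ) : 0 ≤ argPos z := (toIcoMod_mem_Ico' Real.two_pi_pos _).1

lemma argPos_lt (z : ℂ) : argPos z < 2 * Real.pi := (toIcoMod_mem_Ico' Real.two_pi_pos _).2

lemma coe_argPos (z : ℂ) : (argPos z : Real.Angle) = Complex.arg z := by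
  rw [Real.Angle.angle_eq_iff_two_pi_dvd_sub]
  obtain ⟨-, k, hk⟩ := (toIcoMod_eq_iff Real.two_pi_pos (a := 0)).1
    (rfl : argPos z = argPos z)
  refine ⟨-k, ?_⟩
  rw [hk]; simp; ring

lemma argPos_eq_of_coe {z : ℂ} {θ : ℝ} (h0 : 0 ≤ θ) (h1 : θ < 2 * Real.pi)
    (h : (θ : Real.Angle) = Complex.arg z) : argPos z = θ := by
  obtain ⟨k, hk⟩ := Real.Angle.angle_eq_iff_two_pi_dvd_sub.1 h
  refine (toIcoMod_eq_iff Real.two_pi_pos).2 ⟨⟨h0, by simpa using h1⟩, -k, ?_⟩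
  simp; linarith

lemma argPos_one : argPos 1 = 0 :=
  argPos_eq_of_coe le_rfl Real.two_pi_pos (by simp)

lemma im_eq_norm_mul_sin_argPos (z : ℂ) : z.im = ‖z‖ * Real.sin (argPos z) := by
  rw [← Real.Angle.sin_coe, coe_argPos, Real.Angle.sin_coe, Complex.norm_mul_sin_arg]

lemma re_eq_norm_mul_cos_argPos (z : ℂ) : z.re = ‖z‖ * Real.cos (argPos z) := by
  rw [← Real.Angle.cos_coe, coe_argPos, Real.Angle.cos_coe, Complex.norm_mul_cos_arg]

/-- If the argument of `w` exceeds that of `z`, it does so by the argument of the quotient. -/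
lemma argPos_div {z w : ℂ} (hz : z ≠ 0) (hw : w ≠ 0) (h : argPos z ≤ argPos w) :
    argPos (w / z) = argPos w - argPos z := by
  refine argPos_eq_of_coe (by linarith) (by linarith [argPos_nonneg z, argPos_lt w]) ?_
  rw [Complex.arg_div_coe_angle hw hz, Real.Angle.coe_sub, coe_argPos, coe_argPos]

/-- A rotation by less than `π` increases the argument, unless it passes the positive real axis. -/
lemma argPos_lt_argPos {z w : ℂ} (hz : z ≠ 0) (hw : w ≠ 0)
    (h : 0 < z.re * w.im - z.im * w.re) (hwrap : z.im < 0 → w.im < 0) :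
    argPos z < argPos w := by
  have hd : 0 < (w / z).im := by
    rw [Complex.div_im, ← sub_div]
    exact div_pos (by linarith) (Complex.normSq_pos.2 hz)
  have hd1 : 0 < argPos (w / z) := by
    rcases (argPos_nonneg (w / z)).eq_or_lt with h' | h'
    · rw [im_eq_norm_mul_sin_argPos, ← h'] at hd
      simp at hd
    · exact h'
  have hd2 : argPos (w / z) < Real.pi := by
    by_contra! h'
    have h3 : Real.sin (argPos (w / z)) ≤ 0 := by
      rw [← Real.sin_sub_two_pi]
      exact Real.sin_nonpos_of_nonpos_of_neg_pi_le (by linarith [argPos_lt (w / z)]) (by linarith)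
    rw [im_eq_norm_mul_sin_argPos] at hd
    nlinarith [norm_nonneg (w / z)]
  by_cases hlt : argPos z + argPos (w / z) < 2 * Real.pi
  · have : argPos w = argPos z + argPos (w / z) := by
      refine argPos_eq_of_coe (by linarith [argPos_nonneg z]) hlt ?_
      rw [Real.Angle.coe_add, coe_argPos, coe_argPos, Complex.arg_div_coe_angle hw hz]
      abel
    linarith
  -- If the sum reached `2π`, then `argPos z > π`, so `z` would be below the real axis, while
  -- `argPos w` would lie in `[0, π)`. This is the wrap that `hwrap` excludes.
  · exfalso
    push Not at hlt
    have hw' : argPos w = argPos z + argPos (w / z) - 2 * Real.pi := by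
      refine argPos_eq_of_coe (by linarith) (by linarith [argPos_lt z, Real.pi_pos]) ?_
      rw [Real.Angle.coe_sub, Real.Angle.coe_two_pi, Real.Angle.coe_add, coe_argPos, coe_argPos,
        Complex.arg_div_coe_angle hw hz]
      abel
    have hz' : z.im < 0 := by
      rw [im_eq_norm_mul_sin_argPos, ← Real.sin_sub_two_pi]
      exact mul_neg_of_pos_of_neg (norm_pos_iff.2 hz)
        (Real.sin_neg_of_neg_of_neg_pi_lt (by linarith [argPos_lt z]) (by linarith))
    have := hwrap hz'
    rw [im_eq_norm_mul_sin_argPos] at this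
    have h4 : 0 ≤ Real.sin (argPos w) :=
      Real.sin_nonneg_of_nonneg_of_le_pi (argPos_nonneg w) (by linarith [argPos_lt z])
    nlinarith [norm_nonneg w]

/-! ### Turning of the sides and lengths of chords -/

section Polygon

variable {N : ℕ} [NeZero N] {v : ZMod N → ℂ}

/-- The direction of the `m`-th side of the polygon, counted from the vertex `b`. -/
def side (v : ZMod N → ℂ) (b : ZMod N) (m : ℕ) : ℂ :=
  v (b + ((m + 1 : ℕ) : ZMod N)) - v (b + (m : ZMod N))

/-- The angle between the side at the vertex `b` and the `m`-th side after it. -/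
def sideAngle (v : ZMod N → ℂ) (b : ZMod N) (m : ℕ) : ℝ := argPos (side v b m / side v b 0)

lemma side_ne_zero (hv : IsConvexPolygon v) (hN : 2 ≤ N) (b : ZMod N) (m : ℕ) :
    side v b m ≠ 0 := by
  have : Fact (1 < N) := ⟨hN⟩
  rw [side, Ne, sub_eq_zero, hv.injective.eq_iff]
  simp

/-- The orientation of two vectors. -/
def cv (z w : ℂ) : ℝ := z.re * w.im - z.im * w.re

lemma cv_side_succ_pos (hv : IsConvexPolygon v) (hN : 3 ≤ N) (b : ZMod N) (m : ℕ) :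
    0 < cv (side v b m) (side v b (m + 1)) := by
  have h := cr_pos hv (b + (m : ZMod N)) (r := 0) (s := 1) (t := 2) (by omega) (by omega) hN
  have e1 : b + (m : ZMod N) + ((1 : ℕ) : ZMod N) = b + ((m + 1 : ℕ) : ZMod N) := by
    push_cast; ring
  have e2 : b + (m : ZMod N) + ((2 : ℕ) : ZMod N) = b + ((m + 1 + 1 : ℕ) : ZMod N) := by
    push_cast; ring
  rw [e1, e2, Nat.cast_zero, add_zero] at h
  simp only [cv, side, cr, Complex.sub_re, Complex.sub_im] at h ⊢
  linarith

/-- This supplies the wrap condition of `argPos_lt_argPos`: the sides do not complete a full turn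
before the polygon closes up, hence the bound `m + 1 < N`. -/
lemma cv_side_neg (hv : IsConvexPolygon v) (hN : 3 ≤ N) (b : ZMod N) {m : ℕ} (hm : m + 1 < N)
    (h : cv (side v b 0) (side v b m) < 0) : cv (side v b 0) (side v b (m + 1)) < 0 := by
  have hm0 : 0 < m := by
    rcases Nat.eq_zero_or_pos m with rfl | h'
    · simp only [cv] at h; linarith
    · exact h'
  have h1 := cr_pos hv b (r := 0) (s := 1) (t := m + 1) (by omega) (by omega) hm
  rcases (show m + 2 ≤ N by omega).eq_or_lt with hN' | hN'
  · have e : b + ((m + 1 + 1 : ℕ) : ZMod N) = b + ((0 : ℕ) : ZMod N) := by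
      rw [show m + 1 + 1 = N by omega]; simp
    simp only [cv, side, cr, e, Complex.sub_re, Complex.sub_im] at h1 ⊢
    simp only [zero_add]
    linarith
  · have h2 := cr_pos hv b (r := 0) (s := m) (t := m + 1) (by omega) (by omega) hm
    have h3 := cr_pos hv b (r := 0) (s := m + 1) (t := m + 2) (by omega) (by omega) hN'
    have h4 := cv_side_succ_pos hv hN b m
    by_contra! h5
    -- The Plücker relation between the sides `0`, `m`, `m + 1` and the vector from the vertex `b`
    -- to the vertex `b + (m + 1)`. By convexity the left side is positive, whereas `h` and `h5`
    -- would make the right side negative.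
    have key : cr (v (b + ((0 : ℕ) : ZMod N))) (v (b + ((1 : ℕ) : ZMod N)))
          (v (b + ((m + 1 : ℕ) : ZMod N))) * cv (side v b m) (side v b (m + 1)) =
        cv (side v b 0) (side v b m) * cr (v (b + ((0 : ℕ) : ZMod N)))
          (v (b + ((m + 1 : ℕ) : ZMod N))) (v (b + ((m + 2 : ℕ) : ZMod N))) -
        cv (side v b 0) (side v b (m + 1)) * cr (v (b + ((0 : ℕ) : ZMod N)))
          (v (b + (m : ZMod N))) (v (b + ((m + 1 : ℕ) : ZMod N))) := by
      simp only [cv, side, cr, Complex.sub_re, Complex.sub_im, zero_add]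
      ring
    nlinarith [mul_pos h1 h4, mul_neg_of_neg_of_pos h h3, mul_nonneg h5 h2.le]

lemma sideAngle_lt_succ (hv : IsConvexPolygon v) (hN : 3 ≤ N) (b : ZMod N) {m : ℕ}
    (hm : m + 1 < N) : sideAngle v b m < sideAngle v b (m + 1) := by
  have hne := fun m => side_ne_zero hv (by omega) b m
  have hpos := Complex.normSq_pos.2 (hne 0)
  have him : ∀ k, (side v b k / side v b 0).im =
      cv (side v b 0) (side v b k) / Complex.normSq (side v b 0) := by
    intro k; rw [Complex.div_im, cv]; ring
  refine argPos_lt_argPos (div_ne_zero (hne _) (hne _)) (div_ne_zero (hne _) (hne _)) ?_ ?_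
  · have h := cv_side_succ_pos hv hN b m
    have e : (side v b m / side v b 0).re * (side v b (m + 1) / side v b 0).im -
        (side v b m / side v b 0).im * (side v b (m + 1) / side v b 0).re =
        cv (side v b m) (side v b (m + 1)) / Complex.normSq (side v b 0) := by
      simp only [Complex.div_im, Complex.div_re, cv]
      field_simp
      rw [Complex.normSq_apply]
      ring
    rw [e]; positivity
  · rw [him, him, div_neg_iff, div_neg_iff]
    rintro (⟨-, h⟩ | ⟨h, -⟩)
    · linarith
    · exact Or.inr ⟨cv_side_neg hv hN b hm h, hpos⟩

lemma sideAngle_mono (hv : IsConvexPolygon v) (hN : 3 ≤ N) (b : ZMod N) {k m : ℕ}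
    (hkm : k ≤ m) (hm : m < N) : sideAngle v b k ≤ sideAngle v b m := by
  induction m, hkm using Nat.le_induction with
  | base => exact le_rfl
  | succ m h ih => exact (ih (by omega)).trans (sideAngle_lt_succ hv hN b hm).le

lemma argPos_side_div (hv : IsConvexPolygon v) (hN : 3 ≤ N) (b : ZMod N) {k m : ℕ}
    (hkm : k ≤ m) (hm : m < N) :
    argPos (side v b m / side v b k) = sideAngle v b m - sideAngle v b k := by
  have hne := fun m => side_ne_zero hv (by omega) b m
  rw [sideAngle, sideAngle, ← argPos_div (div_ne_zero (hne _) (hne _))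
    (div_ne_zero (hne _) (hne _)) (sideAngle_mono hv hN b hkm hm),
    div_div_div_cancel_right₀ (hne 0)]

/-- Turning angles become differences of one increasing function, so those of disjoint arcs can be
summed. The shift in the index is there because side `m` ends at the vertex `m + 1`. -/
lemma turningAngle_eq (hv : IsConvexPolygon v) (hN : 3 ≤ N) (b : ZMod N) {k m : ℕ}
    (hkm : k ≤ m) (hm : m < N) :
    turningAngle v (b + (k : ZMod N)) (b + ((m + 1 : ℕ) : ZMod N)) =
      sideAngle v b m - sideAngle v b k := by
  rw [← argPos_side_div hv hN b hkm hm]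
  simp only [turningAngle, argPos, side]
  have e1 : b + ((m + 1 : ℕ) : ZMod N) - 1 = b + (m : ZMod N) := by push_cast; ring
  have e2 : b + (k : ZMod N) + 1 = b + ((k + 1 : ℕ) : ZMod N) := by push_cast; ring
  rw [e1, e2]

lemma turningAngle_eq_of_val (hv : IsConvexPolygon v) (hN : 3 ≤ N) (b : ZMod N) {i j : ZMod N}
    (h : (i - b).val < (j - b).val) :
    turningAngle v i j = sideAngle v b ((j - b).val - 1) - sideAngle v b (i - b).val := by
  have hj := ZMod.val_lt (j - b)
  have := turningAngle_eq hv hN b (k := (i - b).val) (m := (j - b).val - 1) (by omega) (by omega)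
  rwa [Nat.sub_add_cancel (by omega), add_val_sub, add_val_sub] at this

lemma val_sub_eq_ite (b x y : ZMod N) : (y - x).val =
    if (x - b).val ≤ (y - b).val then (y - b).val - (x - b).val
    else N + (y - b).val - (x - b).val := by
  have hx := ZMod.val_lt (x - b)
  have hy := ZMod.val_lt (y - b)
  have e : y - x = ((y - b).val : ZMod N) - ((x - b).val : ZMod N) := by simp
  split_ifs with h
  · rw [e, ← Nat.cast_sub h, ZMod.val_natCast_of_lt (by omega)]
  · have : ((y - b).val : ZMod N) - ((x - b).val : ZMod N) =
        ((N + (y - b).val - (x - b).val : ℕ) : ZMod N) := by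
      rw [Nat.cast_sub (by omega)]; simp
    rw [e, this, ZMod.val_natCast_of_lt (by omega)]

/-- There are no four pairwise disjoint arcs with turning angle greater than `π / 2`. -/
lemma not_four_arcs (hv : IsConvexPolygon v) (hN : 3 ≤ N) (i j : Fin 4 → ZMod N)
    (hij : ∀ k, i k ≠ j k)
    (hi : ∀ k l, k ≠ l → (j k - i k).val < (i l - i k).val)
    (hj : ∀ k l, k ≠ l → (j k - i k).val < (j l - i k).val)
    (hτ : ∀ k, Real.pi / 2 < turningAngle v (i k) (j k)) : False := by
  -- Counting from `i 0`, no arc runs over the base point, so each arc is an honest interval of side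
  -- indices.
  have hlt : ∀ l, (i l - i 0).val < (j l - i 0).val := by
    intro l
    rcases eq_or_ne l 0 with rfl | hl
    · rw [sub_self, ZMod.val_zero]; exact val_pos_of_ne (hij 0).symm
    · have h1 := hi l 0 hl
      have h2 := hi 0 l hl.symm
      have h3 := hj 0 l hl.symm
      have h4 : (i l - i 0).val ≠ (j l - i 0).val := fun h => hij l (val_sub_inj h)
      rw [val_sub_eq_ite (i 0) (i l) (j l), val_sub_eq_ite (i 0) (i l) (i 0)] at h1
      simp only [sub_self, ZMod.val_zero] at h1
      split_ifs at h1 <;> omega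
  have hmono : ∀ k l, (j k - i 0).val < (i l - i 0).val →
      sideAngle v (i 0) ((j k - i 0).val - 1) ≤ sideAngle v (i 0) (i l - i 0).val := fun k l h =>
    sideAngle_mono hv hN _ (by omega) (ZMod.val_lt _)
  have hdisj : ∀ k l, k ≠ l →
      sideAngle v (i 0) ((j k - i 0).val - 1) ≤ sideAngle v (i 0) (i l - i 0).val ∨
      sideAngle v (i 0) ((j l - i 0).val - 1) ≤ sideAngle v (i 0) (i k - i 0).val := by
    intro k l hkl
    have h1 := hi k l hkl
    have h2 := hi l k hkl.symm
    rw [val_sub_eq_ite (i 0) (i k), val_sub_eq_ite (i 0) (i k)] at h1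
    rw [val_sub_eq_ite (i 0) (i l), val_sub_eq_ite (i 0) (i l)] at h2
    have hk := hlt k
    have hl := hlt l
    have hk' := ZMod.val_lt (j k - i 0)
    have hl' := ZMod.val_lt (j l - i 0)
    rcases lt_or_ge (j k - i 0).val (i l - i 0).val with h | h
    · exact Or.inl (hmono k l h)
    · refine Or.inr (hmono l k ?_)
      split_ifs at h1 h2 <;> omega
  have hbase : ∀ l, l ≠ 0 → sideAngle v (i 0) ((j 0 - i 0).val - 1) ≤
      sideAngle v (i 0) (i l - i 0).val := fun l hl => hmono 0 l (hi 0 l hl.symm)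
  have h0 : sideAngle v (i 0) (i 0 - i 0).val = 0 := by
    rw [sub_self, ZMod.val_zero, sideAngle, div_self (side_ne_zero hv (by omega) _ _), argPos_one]
  have htop : ∀ l, sideAngle v (i 0) ((j l - i 0).val - 1) < 2 * Real.pi := fun l => argPos_lt _
  have hτ' : ∀ l, Real.pi / 2 < sideAngle v (i 0) ((j l - i 0).val - 1) -
      sideAngle v (i 0) (i l - i 0).val := fun l =>
    turningAngle_eq_of_val hv hN (i 0) (hlt l) ▸ hτ l
  have b1 := hbase 1 (by decide)
  have b2 := hbase 2 (by decide)
  have b3 := hbase 3 (by decide)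
  have t0 := hτ' 0
  have t1 := hτ' 1
  have t2 := hτ' 2
  have t3 := hτ' 3
  have u1 := htop 1
  have u2 := htop 2
  have u3 := htop 3
  -- Arc `0` comes first. For every order of the other three, four consecutive increments greater
  -- than `π / 2` would have to fit below `2π`.
  rcases hdisj 1 2 (by decide) with h12 | h12 <;> rcases hdisj 1 3 (by decide) with h13 | h13 <;>
    rcases hdisj 2 3 (by decide) with h23 | h23 <;> linarith

lemma sum_side (b : ZMod N) {k m : ℕ} (hkm : k ≤ m) :
    ∑ t ∈ Finset.Ico k m, side v b t = v (b + (m : ZMod N)) - v (b + (k : ZMod N)) :=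
  Finset.sum_Ico_sub (fun t : ℕ => v (b + (t : ZMod N))) hkm

/-- The angle between two sides of the arc is a part of the turning angle of the whole arc, so it
has a nonnegative cosine. -/
lemma inner_side_nonneg (hv : IsConvexPolygon v) (hN : 3 ≤ N) {i j : ZMod N}
    (hτ : turningAngle v i j ≤ Real.pi / 2) {a b : ℕ} (ha : a < (j - i).val)
    (hb : b < (j - i).val) : 0 ≤ inner ℝ (side v i a) (side v i b) := by
  wlog hab : a ≤ b generalizing a b
  · rw [real_inner_comm]; exact this hb ha (by omega)
  have hlt := ZMod.val_lt (j - i)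
  have h := argPos_side_div hv hN i hab (by omega)
  rw [turningAngle_eq_of_val hv hN i (by rw [sub_self, ZMod.val_zero]; omega)] at hτ
  have h1 := sideAngle_mono hv hN i (k := 0) (m := a) (by omega) (by omega)
  have h2 := sideAngle_mono hv hN i (k := b) (m := (j - i).val - 1) (by omega) (by omega)
  have h3 : 0 ≤ (side v i b / side v i a).re := by
    rw [re_eq_norm_mul_cos_argPos]
    refine mul_nonneg (norm_nonneg _) (Real.cos_nonneg_of_neg_pi_div_two_le_of_le ?_ ?_)
    · linarith [argPos_nonneg (side v i b / side v i a), Real.pi_pos]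
    · rw [sub_self, ZMod.val_zero] at hτ
      linarith
  have hpos := Complex.normSq_pos.2 (side_ne_zero hv (by omega) i a)
  rw [Complex.div_re, ← add_div] at h3
  have h4 := (div_nonneg_iff.1 h3).resolve_right (fun h => by linarith [h.2])
  rw [Complex.inner]
  simp
  linarith [h4.1]

/-- If the turning angle of `(i, j)` is at most `π / 2`, then no chord of the arc from `i` to `j`
is longer than the chord from `i` to `j`. -/
lemma dist_le_of_turningAngle_le (hv : IsConvexPolygon v) {i j : ZMod N}
    (hτ : turningAngle v i j ≤ Real.pi / 2) {a b : ℕ} (hab : a < b) (hb : b ≤ (j - i).val) :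
    dist (v (i + (a : ZMod N))) (v (i + (b : ZMod N))) ≤ dist (v i) (v j) := by
  have hlt := ZMod.val_lt (j - i)
  rcases lt_or_ge N 3 with hN | hN
  · obtain rfl : a = 0 := by omega
    obtain rfl : b = (j - i).val := by omega
    simp
  · have e1 := sum_side (v := v) i (Nat.zero_le a)
    have e2 := sum_side (v := v) i hab.le
    have e3 := sum_side (v := v) i hb
    rw [add_val_sub] at e3
    rw [Nat.cast_zero, add_zero] at e1
    rw [dist_comm, dist_comm (v i), dist_eq_norm, dist_eq_norm, ← e2]
    -- The long chord is the inner chord `x` plus the sum `y` of the remaining sides. As `x` and `y`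
    -- have nonnegative inner product, `‖x + y‖ ≥ ‖x‖`.
    have e : v j - v i = ∑ t ∈ Finset.Ico a b, side v i t +
        (∑ t ∈ Finset.Ico 0 a, side v i t + ∑ t ∈ Finset.Ico b (j - i).val, side v i t) := by
      rw [e1, e2, e3]; ring
    have hin : 0 ≤ inner ℝ (∑ t ∈ Finset.Ico a b, side v i t)
        (∑ t ∈ Finset.Ico 0 a, side v i t + ∑ t ∈ Finset.Ico b (j - i).val, side v i t) := by
      rw [inner_add_right, sum_inner, sum_inner]
      simp only [inner_sum]
      refine add_nonneg (Finset.sum_nonneg fun s hs => Finset.sum_nonneg fun t ht => ?_)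
        (Finset.sum_nonneg fun s hs => Finset.sum_nonneg fun t ht => ?_) <;>
      · rw [Finset.mem_Ico] at hs ht
        exact inner_side_nonneg hv hN hτ (by omega) (by omega)
    rw [e]
    refine abs_le_of_sq_le_sq' ?_ (norm_nonneg _) |>.2
    rw [norm_add_sq_real]
    nlinarith [sq_nonneg ‖∑ t ∈ Finset.Ico 0 a, side v i t +
      ∑ t ∈ Finset.Ico b (j - i).val, side v i t‖]

end Polygon

/-! ### Matchings of coloured points on a line -/

/-- The weight of a colour: `1` for red and `-1` for blue. -/
def wt (b : Bool) : ℤ := if b then 1 else -1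

lemma wt_add_eq_zero {a b : Bool} (h : a ≠ b) : wt a + wt b = 0 := by
  cases a <;> cases b <;> simp_all [wt]

lemma ne_of_wt_eq_neg {a b : Bool} (h : wt b = -wt a) : b ≠ a := by
  cases a <;> cases b <;> simp_all [wt]

lemma wt_mul_self (a : Bool) : wt a * wt a = 1 := by
  cases a <;> simp [wt]

lemma neg_one_le_wt_mul (a b : Bool) : -1 ≤ wt a * wt b := by
  cases a <;> cases b <;> simp [wt]

/-- A crossing-free bichromatic perfect matching of the points `lo, …, hi - 1` on a line. -/
structure LinearMatching (w : ℕ → Bool) (lo hi : ℕ) (p : ℕ → ℕ) : Prop where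
  maps : ∀ a, lo ≤ a → a < hi → lo ≤ p a ∧ p a < hi
  invol : ∀ a, lo ≤ a → a < hi → p (p a) = a
  color : ∀ a, lo ≤ a → a < hi → w (p a) ≠ w a
  nested : ∀ a b, lo ≤ a → a < b → b < p a → p a < hi → p b < p a

/-- If `p b < a`, then the pair `(p b, b)` encloses `a` but not `p a`, which contradicts `nested`
for that pair. -/
lemma LinearMatching.lt_of_nested {w : ℕ → Bool} {lo hi : ℕ} {p : ℕ → ℕ}
    (h : LinearMatching w lo hi p) {a b : ℕ} (ha : lo ≤ a) (hab : a < b) (hb : b < p a)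
    (hp : p a < hi) : a < p b := by
  have h1 := h.maps b (by omega) (by omega)
  have h2 := h.invol b (by omega) (by omega)
  have h3 := h.invol a (by omega) (by omega)
  rcases lt_trichotomy (p b) a with h4 | h4 | h4
  · have := h.nested (p b) a h1.1 h4 (by omega) (by omega)
    omega
  · rw [h4] at h2; omega
  · exact h4

lemma LinearMatching.union {w : ℕ → Bool} {lo mid hi : ℕ} {p q : ℕ → ℕ}
    (hp : LinearMatching w lo mid p) (hq : LinearMatching w mid hi q) (h1 : lo ≤ mid)
    (h2 : mid ≤ hi) : LinearMatching w lo hi (fun a => if a < mid then p a else q a) := by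
  have hp1 := hp.maps
  have hp2 := hp.invol
  have hp3 := hp.color
  have hp4 := hp.nested
  have hq1 := hq.maps
  have hq2 := hq.invol
  have hq3 := hq.color
  have hq4 := hq.nested
  constructor <;> grind

lemma LinearMatching.wrap {w : ℕ → Bool} {lo hi : ℕ} {p : ℕ → ℕ}
    (hp : LinearMatching w (lo + 1) hi p) (h : lo < hi) (hc : w hi ≠ w lo) :
    LinearMatching w lo (hi + 1)
      (fun a => if a = lo then hi else if a = hi then lo else p a) := by
  have hp1 := hp.maps
  have hp2 := hp.invol
  have hp3 := hp.color
  have hp4 := hp.nested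
  constructor <;> grind

lemma LinearMatching.restrict {w : ℕ → Bool} {lo hi lo' hi' : ℕ} {p : ℕ → ℕ}
    (hp : LinearMatching w lo hi p) (h1 : lo ≤ lo') (h2 : hi' ≤ hi)
    (hmaps : ∀ a, lo' ≤ a → a < hi' → lo' ≤ p a ∧ p a < hi') : LinearMatching w lo' hi' p where
  maps := hmaps
  invol a ha hb := hp.invol a (by omega) (by omega)
  color a ha hb := hp.color a (by omega) (by omega)
  nested a b h3 h4 h5 h6 := hp.nested a b (by omega) h4 h5 (by omega)

/-- The points `a, …, b - 1` are balanced. -/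
def Balanced (w : ℕ → Bool) (a b : ℕ) : Prop := ∑ t ∈ Finset.Ico a b, wt (w t) = 0

/-- A balanced interval has a matching in which every point is matched with the first point that it
may be matched with. -/
lemma exists_linearMatching (w : ℕ → Bool) : ∀ (len lo hi : ℕ), hi = lo + len → Balanced w lo hi →
    ∃ p, LinearMatching w lo hi p ∧
      ∀ a b, lo ≤ a → a < b → b < p a → p a < hi → ¬ Balanced w a (b + 1) := by
  intro len
  induction len using Nat.strong_induction_on with
  | _ len ih =>
  intro lo hi hlen hbal
  rcases Nat.eq_zero_or_pos len with rfl | hpos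
  · exact ⟨id, ⟨by omega, by omega, by omega, by omega⟩, by omega⟩
  have hlast : lo < hi - 1 := by
    by_contra h
    obtain rfl : hi = lo + 1 := by omega
    simp only [Balanced, Nat.Ico_succ_singleton, Finset.sum_singleton] at hbal
    have := wt_mul_self (w lo)
    simp [hbal] at this
  have hex : ∃ u, lo < u ∧ Balanced w lo (u + 1) :=
    ⟨hi - 1, hlast, by rwa [Nat.sub_add_cancel (by omega)]⟩
  obtain ⟨u, ⟨hu, hubal⟩, hmin⟩ : ∃ u, (lo < u ∧ Balanced w lo (u + 1)) ∧
      ∀ b, lo < b → b < u → ¬ Balanced w lo (b + 1) := by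
    classical
    exact ⟨Nat.find hex, Nat.find_spec hex, fun b hb hbu h => Nat.find_min hex hbu ⟨hb, h⟩⟩
  have huhi : u < hi := by
    by_contra h
    exact hmin (hi - 1) hlast (by omega) (by rwa [Nat.sub_add_cancel (by omega)])
  -- Before `u` the partial sums are nonzero and move in unit steps, so they keep the sign of the
  -- first weight. The step at `u` that brings the sum to zero thus has the opposite colour, and
  -- `lo` can be joined to `u`.
  have hsign : ∀ t, lo ≤ t → t < u → 0 < wt (w lo) * ∑ s ∈ Finset.Ico lo (t + 1), wt (w s) := by
    intro t ht
    induction t, ht using Nat.le_induction with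
    | base => intro _; simp [wt_mul_self]
    | succ t ht iht =>
      intro htu
      have h1 := iht (by omega)
      have h2 := hmin (t + 1) (by omega) htu
      rw [Balanced, Finset.sum_Ico_succ_top (by omega)] at h2
      rw [Finset.sum_Ico_succ_top (by omega), mul_add]
      have h3 := neg_one_le_wt_mul (w lo) (w (t + 1))
      have h4 : wt (w lo) * (∑ s ∈ Finset.Ico lo (t + 1), wt (w s) + wt (w (t + 1))) ≠ 0 :=
        mul_ne_zero (fun h => by simp [h] at h1) h2
      rw [mul_add] at h4
      omega
  have hu1 := hsign (u - 1) (by omega) (by omega)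
  rw [Nat.sub_add_cancel (by omega)] at hu1
  have hub := hubal
  rw [Balanced, Finset.sum_Ico_succ_top (by omega)] at hub
  have huc : wt (w u) = -wt (w lo) := by
    have : ∑ s ∈ Finset.Ico lo u, wt (w s) = -wt (w u) := by omega
    rw [this] at hu1
    revert hu1
    cases w u <;> cases w lo <;> simp [wt]
  have hmid : Balanced w (lo + 1) u := by
    rw [Finset.sum_eq_sum_Ico_succ_bot (by omega)] at hub
    rw [Balanced]; omega
  have hrest : Balanced w (u + 1) hi := by
    have := Finset.sum_Ico_consecutive (fun t => wt (w t)) (show lo ≤ u + 1 by omega)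
      (show u + 1 ≤ hi by omega)
    simp only [Balanced] at *
    omega
  obtain ⟨p, hp, hp'⟩ := ih (u - (lo + 1)) (by omega) (lo + 1) u (by omega) hmid
  obtain ⟨q, hq, hq'⟩ := ih (hi - (u + 1)) (by omega) (u + 1) hi (by omega) hrest
  refine ⟨_, (hp.wrap hu (ne_of_wt_eq_neg huc)).union hq (by omega) (by omega), ?_⟩
  have hp1 := hp.maps
  intro a b h1 h2 h3 h4
  rcases lt_or_ge a (u + 1) with hau | hau
  · rw [if_pos hau] at h3 h4
    rcases eq_or_ne a lo with rfl | hal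
    · rw [if_pos rfl] at h3
      exact hmin b h2 h3
    · rw [if_neg hal] at h3 h4
      rcases eq_or_ne a u with rfl | hau'
      · rw [if_pos rfl] at h3; omega
      · rw [if_neg hau'] at h3
        exact hp' a b (by omega) h2 h3 (hp1 a (by omega) (by omega)).2
  · rw [if_neg (by omega)] at h3 h4
    exact hq' a b hau h2 h3 h4

/-! ### Passage between matchings of the polygon and of a line -/

section Polygon

variable {N : ℕ} [NeZero N] {v : ZMod N → ℂ} {c : ZMod N → Bool}

/-- The colours met when going around from `i` in the positive direction. -/
def colorsFrom (c : ZMod N → Bool) (i : ZMod N) (t : ℕ) : Bool := c (i + (t : ZMod N))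

namespace Matching

lemma partner_ne (M : Matching v c) (i : ZMod N) : M.partner i ≠ i := fun h =>
  M.color_partner_ne i (by rw [h])

/-- The matching that a linear matching of the points, counted from `i`, induces. -/
def ofLinear (hv : IsConvexPolygon v) (i : ZMod N) {p : ℕ → ℕ}
    (hp : LinearMatching (colorsFrom c i) 0 N p) : Matching v c where
  partner x := i + (p (x - i).val : ZMod N)
  partner_partner x := by
    have hx := ZMod.val_lt (x - i)
    rw [val_add_sub i (hp.maps _ (Nat.zero_le _) hx).2, hp.invol _ (Nat.zero_le _) hx, add_val_sub]
  color_partner_ne x := by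
    have := hp.color _ (Nat.zero_le _) (ZMod.val_lt (x - i))
    simpa only [colorsFrom, add_val_sub] using this
  disjoint_segments x y hyx hyp := by
    have key : ∀ a b, a < p a → p a < N → b < N → b ≠ a → b ≠ p a →
        Disjoint (segment ℝ (v (i + (a : ZMod N))) (v (i + (p a : ZMod N))))
          (segment ℝ (v (i + (b : ZMod N))) (v (i + (p b : ZMod N)))) := by
      intro a b ha hpa hb hba hbp
      have hpb := hp.maps b (Nat.zero_le _) hb
      have h1 := hp.invol b (Nat.zero_le _) hb
      have h2 := hp.invol a (Nat.zero_le _) (by omega)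
      have hba' : p b ≠ a := fun h => hbp (by rw [← h, h1])
      have hbp' : p b ≠ p a := fun h => hba (by rw [← h1, h, h2])
      have hin : ∀ b, a < b → b < p a →
          cr (v (i + (a : ZMod N))) (v (i + (p a : ZMod N))) (v (i + (b : ZMod N))) < 0 := by
        intro b h3 h4
        rw [cr_swap_right]
        linarith [cr_pos hv i h3 h4 hpa]
      have hout : ∀ b < N, b < a ∨ p a < b →
          0 < cr (v (i + (a : ZMod N))) (v (i + (p a : ZMod N))) (v (i + (b : ZMod N))) := by
        rintro b hb (h3 | h3)
        · rw [cr_rotate]; exact cr_pos hv i h3 ha hpa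
        · exact cr_pos hv i ha h3 hb
      by_cases hb' : a < b ∧ b < p a
      · exact disjoint_segment_of_neg (hin b hb'.1 hb'.2)
          (hin _ (hp.lt_of_nested (Nat.zero_le _) hb'.1 hb'.2 hpa)
            (hp.nested a b (Nat.zero_le _) hb'.1 hb'.2 hpa))
      · refine disjoint_segment_of_pos (hout b hb (by omega)) (hout _ hpb.2 ?_)
        by_contra h
        have h3 := hp.lt_of_nested (b := p b) (Nat.zero_le a) (by omega) (by omega) hpa
        have h4 := hp.nested a (p b) (Nat.zero_le _) (by omega) (by omega) hpa
        omega
    have hx := ZMod.val_lt (x - i)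
    have hy := ZMod.val_lt (y - i)
    have hpx := hp.maps _ (Nat.zero_le _) hx
    have hne1 : (y - i).val ≠ (x - i).val := fun h => hyx (val_sub_inj h)
    have hne2 : (y - i).val ≠ p (x - i).val := fun h => hyp (by rw [← h, add_val_sub])
    have hne3 : p (x - i).val ≠ (x - i).val := fun h =>
      hp.color _ (Nat.zero_le _) hx (by rw [h])
    have h2 := hp.invol _ (Nat.zero_le _) hx
    rcases lt_or_gt_of_ne hne3 with h | h
    · have := key (p (x - i).val) (y - i).val (by omega) (by omega) hy hne2 (by omega)
      rw [h2, segment_symm, add_val_sub, add_val_sub] at this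
      exact this
    · have := key (x - i).val (y - i).val h hpx.2 hy hne1 hne2
      rw [add_val_sub, add_val_sub] at this
      exact this

@[simp] lemma ofLinear_partner (hv : IsConvexPolygon v) (i : ZMod N) {p : ℕ → ℕ}
    (hp : LinearMatching (colorsFrom c i) 0 N p) (x : ZMod N) :
    (ofLinear hv i hp).partner x = i + (p (x - i).val : ZMod N) := rfl

/-- The pairs of a matching do not cross. -/
lemma val_partner_lt (M : Matching v c) (hv : IsConvexPolygon v) {i x y z : ZMod N}
    (h1 : (x - i).val < (y - i).val) (h2 : (y - i).val < (z - i).val) (hz : M.partner x = z) :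
    (M.partner y - i).val < (z - i).val := by
  by_contra! h3
  have hyx : y ≠ x := by rintro rfl; omega
  have hyz : y ≠ z := by rintro rfl; omega
  have h4 : (z - i).val ≠ (M.partner y - i).val := fun h => by
    have := val_sub_inj h
    rw [← hz] at this
    exact hyx (by rw [← M.partner_partner y, ← this, M.partner_partner])
  have h5 := lt_of_le_of_ne h3 h4
  have hd := M.disjoint_segments x y hyx (hz ▸ hyz)
  rw [hz] at hd
  exact not_disjoint_diagonals (cr_pos_of_val hv h1 h2) (cr_pos_of_val hv h1 (h2.trans h5))
    (cr_pos_of_val hv (h1.trans h2) h5) (cr_pos_of_val hv h2 h5) hd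

/-- The linear matching that a matching induces on the points counted from `i`. -/
lemma toLinear (M : Matching v c) (hv : IsConvexPolygon v) (i : ZMod N) :
    LinearMatching (colorsFrom c i) 0 N (fun a => (M.partner (i + (a : ZMod N)) - i).val) where
  maps a _ _ := ⟨Nat.zero_le _, ZMod.val_lt _⟩
  invol a _ ha := by rw [add_val_sub, M.partner_partner, val_add_sub i ha]
  color a _ ha := by
    rw [colorsFrom, add_val_sub]
    exact M.color_partner_ne _
  nested a b _ hab hb hp := by
    refine M.val_partner_lt hv (x := i + (a : ZMod N)) ?_ ?_ rfl
    · rw [val_add_sub i (by omega), val_add_sub i (by omega)]; exact hab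
    · rwa [val_add_sub i (by omega)]

/-- The points on the arc of a pair of a matching are matched among themselves. -/
lemma val_partner_le (M : Matching v c) (hv : IsConvexPolygon v) {i x : ZMod N}
    (h : (x - i).val ≤ (M.partner i - i).val) :
    (M.partner x - i).val ≤ (M.partner i - i).val := by
  rcases eq_or_ne x i with rfl | hxi
  · exact le_rfl
  · rcases h.eq_or_lt with h | h
    · rw [val_sub_inj h, M.partner_partner, sub_self, ZMod.val_zero]; exact Nat.zero_le _
    · refine (M.val_partner_lt hv ?_ h rfl).le
      rw [sub_self, ZMod.val_zero]
      exact val_pos_of_ne hxi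

/-- No pair crosses the chord at `i`, so the arc and its complement (`toLinear_right`) are matched
separately and one can be changed without the other. The `+ 1` puts both ends of the chord into the
arc. -/
lemma toLinear_left (M : Matching v c) (hv : IsConvexPolygon v) (i : ZMod N) :
    LinearMatching (colorsFrom c i) 0 ((M.partner i - i).val + 1)
      (fun a => (M.partner (i + (a : ZMod N)) - i).val) := by
  have hlt := ZMod.val_lt (M.partner i - i)
  refine (M.toLinear hv i).restrict le_rfl hlt fun a _ ha => ⟨Nat.zero_le _, ?_⟩
  refine Nat.lt_succ_of_le (M.val_partner_le hv ?_)
  rw [val_add_sub i (by omega)]; omega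

lemma toLinear_right (M : Matching v c) (hv : IsConvexPolygon v) (i : ZMod N) :
    LinearMatching (colorsFrom c i) ((M.partner i - i).val + 1) N
      (fun a => (M.partner (i + (a : ZMod N)) - i).val) := by
  refine (M.toLinear hv i).restrict (Nat.zero_le _) le_rfl fun a ha ha' => ⟨?_, ZMod.val_lt _⟩
  by_contra! h
  have := M.val_partner_le hv (Nat.le_of_lt_succ h)
  rw [M.partner_partner, val_add_sub i ha'] at this
  omega

end Matching

/-! ### Feasible pairs, edges and replacement inside an arc -/

lemma LinearMatching.balanced {w : ℕ → Bool} {lo hi : ℕ} {p : ℕ → ℕ}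
    (hp : LinearMatching w lo hi p) : Balanced w lo hi := by
  refine Finset.sum_involution (fun a _ => p a) ?_ ?_ ?_ ?_
  · intro a ha
    rw [Finset.mem_Ico] at ha
    exact wt_add_eq_zero (hp.color a ha.1 ha.2).symm
  · intro a ha _ h
    rw [Finset.mem_Ico] at ha
    exact hp.color a ha.1 ha.2 (by rw [h])
  · intro a ha
    rw [Finset.mem_Ico] at ha ⊢
    exact hp.maps a ha.1 ha.2
  · intro a ha
    rw [Finset.mem_Ico] at ha
    exact hp.invol a ha.1 ha.2

/-- The chord encloses complete pairs only, whose weights cancel. This necessary condition is what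
shows that no earlier point is feasible. -/
lemma Feasible.balanced (hv : IsConvexPolygon v) {i : ZMod N} {k : ℕ} (hk : k < N)
    (h : Feasible v c i (i + (k : ZMod N))) : Balanced (colorsFrom c i) 0 (k + 1) := by
  obtain ⟨M, hM⟩ := h
  have := (M.toLinear_left hv i).balanced
  rwa [hM, val_add_sub i hk] at this

lemma Feasible.symm {i j : ZMod N} (h : Feasible v c i j) : Feasible v c j i := by
  obtain ⟨M, rfl⟩ := h
  exact ⟨M, M.partner_partner i⟩

lemma IsEdge.symm {i j : ZMod N} (h : IsEdge v c i j) : IsEdge v c j i := ⟨h.1.symm, h.2.symm⟩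

lemma IsDiagonal.symm {i j : ZMod N} (h : IsDiagonal v c i j) : IsDiagonal v c j i :=
  ⟨h.1.symm, fun h' => h.2 h'.symm⟩

/-- A feasible pair closes a balanced arc, so a point before `b` could be feasible with `a` only if
it closed such an arc too. -/
lemma o_eq_of_not_balanced (hv : IsConvexPolygon v) (i : ZMod N) {a b : ℕ} (hab : a < b)
    (hb : b < N) (h : Feasible v c (i + (a : ZMod N)) (i + (b : ZMod N)))
    (hmin : ∀ t, a < t → t < b → ¬ Balanced (colorsFrom c i) a (t + 1)) :
    o v c (i + (a : ZMod N)) = i + (b : ZMod N) := by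
  have hleast : IsLeast {k : ℕ | Feasible v c (i + (a : ZMod N))
      (i + (a : ZMod N) + (k : ZMod N))} (b - a) := by
    constructor
    · change Feasible _ _ _ _
      rw [Nat.cast_sub hab.le]
      convert h using 1
      ring
    · intro k hk
      by_contra! hlt
      have hbal := Feasible.balanced hv (by omega) hk
      rcases Nat.eq_zero_or_pos k with rfl | hk0
      · obtain ⟨M, hM⟩ := hk
        rw [Nat.cast_zero, add_zero] at hM
        exact M.partner_ne _ hM
      · refine hmin (a + k) (by omega) (by omega) ?_
        rw [Balanced] at hbal ⊢
        rw [← hbal]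
        have := Finset.sum_Ico_add' (fun t => wt (colorsFrom c i t)) 0 (k + 1) a
        rw [zero_add, show k + 1 + a = a + k + 1 by omega] at this
        rw [← this]
        refine Finset.sum_congr rfl fun t _ => ?_
        simp only [colorsFrom, Nat.cast_add]
        congr 2
        ring
  rw [o, hleast.csInf_eq, Nat.cast_sub hab.le]
  ring

/-- The condition `hmin` is vacuous for the later of the two points, and for the earlier one it says
that its partner is its image under `o`. Stating it for both ends avoids ordering them. -/
lemma not_isDiagonal_of_not_balanced (hv : IsConvexPolygon v) (i : ZMod N)
    {p : ℕ → ℕ} {a : ℕ} (ha : a < N) (hpa : p a < N) (hne : p a ≠ a) (hinv : p (p a) = a)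
    (hmin : ∀ a' b, (a' = a ∨ a' = p a) → a' < b → b < p a' →
      ¬ Balanced (colorsFrom c i) a' (b + 1)) :
    ¬ IsDiagonal v c (i + (a : ZMod N)) (i + (p a : ZMod N)) := by
  intro h
  refine h.2 ⟨h.1, ?_⟩
  rcases lt_or_gt_of_ne hne with hlt | hlt
  · left
    refine (o_eq_of_not_balanced hv i hlt ha h.1.symm fun t h1 h2 => ?_).symm
    exact hmin _ t (Or.inr rfl) h1 (by rwa [hinv])
  · right
    exact (o_eq_of_not_balanced hv i hlt hpa h.1 fun t h1 h2 => hmin _ t (Or.inl rfl) h1 h2).symm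

/-- The part of a matching on the arc of one of its pairs can be replaced by edges. -/
lemma Matching.exists_replace (M : Matching v c) (hv : IsConvexPolygon v) (i : ZMod N) :
    ∃ M' : Matching v c,
      (∀ x, (M.partner i - i).val < (x - i).val → M'.partner x = M.partner x) ∧
      ∀ x, (x - i).val ≤ (M.partner i - i).val →
        (M'.partner x - i).val ≤ (M.partner i - i).val ∧ ¬ IsDiagonal v c x (M'.partner x) := by
  have hK := ZMod.val_lt (M.partner i - i)
  obtain ⟨q, hq, hmin⟩ := exists_linearMatching (colorsFrom c i) ((M.partner i - i).val + 1) 0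
    ((M.partner i - i).val + 1) (by omega) (M.toLinear_left hv i).balanced
  have hun := hq.union (M.toLinear_right hv i) (Nat.zero_le _) (by omega)
  refine ⟨ofLinear hv i hun, fun x hx => ?_, fun x hx => ?_⟩
  · rw [ofLinear_partner, if_neg (by omega), add_val_sub, add_val_sub]
  · have h1 := hq.maps (x - i).val (Nat.zero_le _) (by omega)
    have h2 := hq.invol (x - i).val (Nat.zero_le _) (by omega)
    have h3 := hq.color (x - i).val (Nat.zero_le _) (by omega)
    have he : (ofLinear hv i hun).partner x = i + (q (x - i).val : ZMod N) := by
      rw [ofLinear_partner, if_pos (by omega)]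
    refine ⟨by rw [he, val_add_sub i (by omega)]; omega, ?_⟩
    have := not_isDiagonal_of_not_balanced (v := v) (c := c) hv i (p := q) (a := (x - i).val)
      (by omega) (by omega) (fun h => h3 (by rw [h])) h2 ?_
    · rwa [add_val_sub, ← he] at this
    · rintro a b (rfl | rfl) h4 h5
      · exact hmin _ _ (Nat.zero_le _) h4 h5 h1.2
      · exact hmin _ _ (Nat.zero_le _) h4 h5 (by omega)

end Polygon

lemma exists_matching {n : ℕ} [NeZero (2 * n)] {v : ZMod (2 * n) → ℂ} {c : ZMod (2 * n) → Bool}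
    (hv : IsConvexPolygon v) (hc : IsBalanced c) : Nonempty (Matching v c) := by
  have hbal : Balanced (colorsFrom c 0) 0 (2 * n) := by
    have h1 : ∑ x : ZMod (2 * n), wt (c x) = 0 := by
      have h2 := hc.1
      have h3 := hc.2
      rw [Set.ncard_eq_toFinset_card'] at h2 h3
      simp only [wt]
      rw [Finset.sum_ite]
      simp at h2 h3 ⊢
      omega
    rw [Balanced, ← h1]
    refine Finset.sum_bij (fun t _ => (t : ZMod (2 * n))) (fun _ _ => Finset.mem_univ _) ?_ ?_ ?_
    · intro a ha b hb h
      simp only [Finset.mem_Ico] at ha hb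
      have := congrArg ZMod.val h
      rwa [ZMod.val_natCast_of_lt ha.2, ZMod.val_natCast_of_lt hb.2] at this
    · intro x _
      exact ⟨x.val, by simp [ZMod.val_lt], by simp⟩
    · intro t _
      simp [colorsFrom]
  obtain ⟨p, hp, -⟩ := exists_linearMatching (colorsFrom c 0) (2 * n) 0 (2 * n) (by omega) hbal
  exact ⟨Matching.ofLinear hv 0 hp⟩

/-! ### The extremal bottleneck matching -/

section Polygon

variable {N : ℕ} [NeZero N] {v : ZMod N → ℂ} {c : ZMod N → Bool}

instance : Finite (Matching v c) :=
  Finite.of_injective (fun M : Matching v c => M.partner) fun M M' h => by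
    cases M; cases M'; cases h; rfl

lemma Matching.dist_le_bn (M : Matching v c) (x : ZMod N) :
    dist (v x) (v (M.partner x)) ≤ M.bn :=
  le_ciSup (f := fun i => dist (v i) (v (M.partner i))) (Set.finite_range _).bddAbove x

/-- There is a bottleneck matching all of whose diagonals have turning angle greater than `π / 2`
in both orientations. -/
lemma exists_isBottleneck_turningAngle (hv : IsConvexPolygon v) (h : Nonempty (Matching v c)) :
    ∃ M : Matching v c, M.IsBottleneck ∧ ∀ i, IsDiagonal v c i (M.partner i) →
      Real.pi / 2 < turningAngle v i (M.partner i) := by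
  classical
  obtain ⟨M₀, hM₀⟩ := Finite.exists_min (fun M : Matching v c => M.bn)
  -- Among the bottleneck matchings, one with the fewest endpoints of diagonals. The exchange below
  -- keeps the pairs outside the arc, leaves no diagonal inside it and frees at least `i`, so it
  -- lowers this number.
  obtain ⟨M, hM, hmin⟩ := Set.exists_min_image {M : Matching v c | M.IsBottleneck}
    (fun M => {x | IsDiagonal v c x (M.partner x)}.ncard) (Set.toFinite _) ⟨M₀, hM₀⟩
  refine ⟨M, hM, fun i hi => ?_⟩
  by_contra! hτ
  obtain ⟨M', hout, hin⟩ := M.exists_replace hv i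
  have hK := ZMod.val_lt (M.partner i - i)
  have hbn : M'.bn ≤ M.bn := by
    refine ciSup_le fun x => ?_
    rcases lt_or_ge (M.partner i - i).val (x - i).val with hx | hx
    · rw [hout x hx]; exact M.dist_le_bn x
    · refine le_trans ?_ (M.dist_le_bn i)
      have h1 := (hin x hx).1
      have hne : (M'.partner x - i).val ≠ (x - i).val := fun h => M'.partner_ne x (val_sub_inj h)
      rcases lt_or_gt_of_ne hne with hlt | hlt
      · have := dist_le_of_turningAngle_le hv hτ hlt hx
        rwa [add_val_sub, add_val_sub, dist_comm] at this
      · have := dist_le_of_turningAngle_le hv hτ hlt h1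
        rwa [add_val_sub, add_val_sub] at this
  refine absurd (hmin M' fun M'' => hbn.trans (hM M'')) (not_le.2 ?_)
  refine Set.ncard_lt_ncard ⟨fun x hx => ?_, fun h => ?_⟩ (Set.toFinite _)
  · change IsDiagonal v c x (M'.partner x) at hx
    change IsDiagonal v c x (M.partner x)
    rcases lt_or_ge (M.partner i - i).val (x - i).val with hx' | hx'
    · rwa [hout x hx'] at hx
    · exact absurd hx (hin x hx').2
  · exact (hin i (by rw [sub_self, ZMod.val_zero]; exact Nat.zero_le _)).2 (h hi)

end Polygon

/-! ### Abstract systems of chords and their cascades -/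

/-- A finite family `D` of non-crossing chords, cutting a disc into the regions `𝓡`: `s e d` is the
side of the chord `e` on which the chord `d` lies, and `σ R e` the side of `e` on which `R` lies. -/
structure ChordSystem {E ρ : Type*} (D : Set E) (𝓡 : Set ρ) (s : E → E → Bool)
    (σ : ρ → E → Bool) : Prop where
  finite : D.Finite
  region_ext : ∀ R ∈ 𝓡, ∀ R' ∈ 𝓡, (∀ d ∈ D, σ R d = σ R' d) → R = R'
  near : ∀ R ∈ 𝓡, ∀ d ∈ D, ∀ e ∈ D, d ≠ e → s d e = σ R d ∨ s e d = σ R e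
  exists_adjacent : ∀ d ∈ D, ∀ b, ∃ R ∈ 𝓡, σ R d = b ∧ ∀ e ∈ D, e ≠ d → s e d = σ R e

/-- No four chords, each with a choice of a side, are such that each of them is on the other sides
of the other three. -/
def NoFourOpposite {E : Type*} (D : Set E) (s : E → E → Bool) : Prop :=
  ∀ x : Fin 4 → E × Bool, (∀ k, (x k).1 ∈ D) →
    (∀ k l, k ≠ l → (x k).1 ≠ (x l).1 ∧ s (x k).1 (x l).1 ≠ (x k).2) → False

namespace ChordSystem

variable {E ρ : Type*} {D : Set E} {𝓡 : Set ρ} {s : E → E → Bool} {σ : ρ → E → Bool}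

/-- The chords that bound a region. -/
def bounding (D : Set E) (s : E → E → Bool) (σ : ρ → E → Bool) (R : ρ) : Set E :=
  {d | d ∈ D ∧ ∀ e ∈ D, e ≠ d → s e d = σ R e}

lemma finite_bounding (h : ChordSystem D 𝓡 s σ) (R : ρ) : (bounding D s σ R).Finite :=
  h.finite.subset fun _ hd => hd.1

/-- A region next to `d` lies on the same side of the other chords as `d`, so `d` can play the role
of a region in `near`. -/
lemma near_chord (h : ChordSystem D 𝓡 s σ) {d e f : E} (hd : d ∈ D) (he : e ∈ D) (hf : f ∈ D)
    (hef : e ≠ f) (hed : e ≠ d) (hfd : f ≠ d) : s e f = s e d ∨ s f e = s f d := by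
  obtain ⟨R, hR, -, h1⟩ := h.exists_adjacent d hd true
  rw [h1 e he hed, h1 f hf hfd]
  exact h.near R hR e he f hf hef

/-- The chord `e` separates the region `R` from the chord `d`. -/
def Sep (D : Set E) (s : E → E → Bool) (σ : ρ → E → Bool) (R : ρ) (e d : E) : Prop :=
  e ∈ D ∧ d ∈ D ∧ e ≠ d ∧ s e d ≠ σ R e

lemma Sep.trans (h : ChordSystem D 𝓡 s σ) {R : ρ} (hR : R ∈ 𝓡) {f e d : E}
    (h1 : Sep D s σ R f e) (h2 : Sep D s σ R e d) : Sep D s σ R f d := by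
  obtain ⟨hf, he, hfe, h1⟩ := h1
  obtain ⟨-, hd, hed, h2⟩ := h2
  have h3 : s e f = σ R e := (h.near R hR f hf e he hfe).resolve_left h1
  have hfd : f ≠ d := by rintro rfl; exact h2 h3
  refine ⟨hf, hd, hfd, ?_⟩
  rcases h.near_chord hd he hf hfe.symm hed hfd with h4 | h4
  · exact absurd (h4.symm.trans h3) h2
  · rwa [← h4]

/-- Separation from a fixed region is a strict order on a finite set. It allows choosing a chord
nearest to `R` and induction on the distance from `R`. -/
lemma wellFounded_sep (h : ChordSystem D 𝓡 s σ) {R : ρ} (hR : R ∈ 𝓡) :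
    WellFounded (Sep D s σ R) := by
  have : IsStrictOrder E (Sep D s σ R) :=
    { irrefl := fun _ h => h.2.2.1 rfl
      trans := fun _ _ _ => Sep.trans h hR }
  have hwf := Set.wellFoundedOn_iff.1 (h.finite.wellFoundedOn (r := Sep D s σ R))
  exact hwf.mono fun a b hab => ⟨hab, hab.1, hab.2.1⟩

/-- One of the chords that bound `R` separates `R` from `R'`. -/
lemma exists_bounding_sep (h : ChordSystem D 𝓡 s σ) {R R' : ρ} (hR : R ∈ 𝓡) (hR' : R' ∈ 𝓡)
    (hne : R ≠ R') : ∃ d ∈ bounding D s σ R, σ R' d ≠ σ R d := by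
  have hex : {d | d ∈ D ∧ σ R' d ≠ σ R d}.Nonempty := by
    by_contra! hcon
    refine hne (h.region_ext R hR R' hR' fun d hd => ?_)
    by_contra hd'
    exact (hcon ▸ (⟨hd, Ne.symm hd'⟩ : d ∈ {d | d ∈ D ∧ σ R' d ≠ σ R d}) : d ∈ (∅ : Set E))
  -- The chord nearest to `R` among those between `R` and `R'`. A chord that cut it off from `R`
  -- would also lie between `R` and `R'`, and nearer.
  obtain ⟨d, ⟨hd, hdσ⟩, hmin⟩ := (h.wellFounded_sep hR).has_min _ hex
  refine ⟨d, ⟨hd, fun e he hed => ?_⟩, hdσ⟩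
  by_contra hcon
  refine hmin e ⟨he, ?_⟩ ⟨he, hd, hed, hcon⟩
  have h1 : s d e = σ R d := (h.near R hR d hd e he hed.symm).resolve_right hcon
  have h2 : s e d = σ R' e :=
    (h.near R' hR' d hd e he hed.symm).resolve_left (by rw [h1]; exact hdσ.symm)
  rwa [← h2]

lemma side_eq_of_bounding {R : ρ} {d e : E} (hd : d ∈ bounding D s σ R)
    (he : e ∈ bounding D s σ R) (hne : d ≠ e) : s d e = σ R d := he.2 d hd.1 hne

/-- The other chords that bound `R` do not separate `R` from `R'`. -/
lemma side_eq_of_sep (h : ChordSystem D 𝓡 s σ) {R R' : ρ} (hR' : R' ∈ 𝓡) {d e : E}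
    (hd : d ∈ bounding D s σ R) (he : e ∈ bounding D s σ R) (hne : d ≠ e)
    (hsep : σ R' d ≠ σ R d) : σ R' e = σ R e := by
  have h1 := side_eq_of_bounding hd he hne
  rcases h.near R' hR' d hd.1 e he.1 hne with h2 | h2
  · exact absurd (h2.symm.trans h1) hsep
  · rw [← h2]; exact side_eq_of_bounding he hd hne.symm

/-- The chords around a region, each with its side away from the region, are pairwise opposite. -/
lemma ncard_bounding_le (h : ChordSystem D 𝓡 s σ) (h4 : NoFourOpposite D s) (R : ρ) :
    (bounding D s σ R).ncard ≤ 3 := by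
  by_contra! hcon
  obtain ⟨t, ht, htc⟩ := Set.exists_subset_card_eq (show 4 ≤ (bounding D s σ R).ncard by omega)
  have : Finite t := (h.finite_bounding R).subset ht
  have e : Fin 4 ≃ t := (Finite.equivFinOfCardEq htc).symm
  refine h4 (fun k => (e k, !σ R (e k))) (fun k => (ht (e k).2).1) fun k l hkl => ?_
  have hne : (e k : E) ≠ e l := fun h => hkl (e.injective (Subtype.ext h))
  refine ⟨hne, ?_⟩
  simp [side_eq_of_bounding (ht (e k).2) (ht (e l).2) hne]

lemma exists_two_other {S : Set E} (hS : 3 ≤ S.ncard) {d : E} (hd : d ∈ S) :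
    ∃ e ∈ S, ∃ f ∈ S, e ≠ d ∧ f ≠ d ∧ e ≠ f := by
  have hfin : S.Finite := Set.finite_of_ncard_pos (by omega)
  have h1 : 1 < (S \ {d}).ncard := by rw [Set.ncard_sdiff_singleton_of_mem hd]; omega
  obtain ⟨e, he, f, hf, hef⟩ := (Set.one_lt_ncard (hfin.sdiff)).1 h1
  exact ⟨e, he.1, f, hf.1, he.2, hf.2, hef⟩

/-- At most one region is bounded by three chords. -/
lemma eq_of_three_le (h : ChordSystem D 𝓡 s σ) (h4 : NoFourOpposite D s) {R R' : ρ}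
    (hR : R ∈ 𝓡) (hR' : R' ∈ 𝓡) (h3 : 3 ≤ (bounding D s σ R).ncard)
    (h3' : 3 ≤ (bounding D s σ R').ncard) : R = R' := by
  by_contra hne
  obtain ⟨d, hd, hdσ⟩ := h.exists_bounding_sep hR hR' hne
  obtain ⟨e, he, heσ⟩ := h.exists_bounding_sep hR' hR (Ne.symm hne)
  obtain ⟨d₁, hd₁, d₂, hd₂, hn₁, hn₂, hn⟩ := exists_two_other h3 hd
  obtain ⟨e₁, he₁, e₂, he₂, hm₁, hm₂, hm⟩ := exists_two_other h3' he
  -- Here `d` leads from `R` towards `R'` and `e` back, possibly `d = e`. The remaining chords face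
  -- away from the other region, so two from each region form four pairwise opposite chords.
  have key : ∀ x ∈ bounding D s σ R, x ≠ d → ∀ y ∈ bounding D s σ R', y ≠ e →
      x ≠ y ∧ s x y = σ R x ∧ s y x = σ R' y := by
    intro x hx hxd y hy hye
    have h1 := h.side_eq_of_sep hR' hd hx hxd.symm hdσ
    have h2 := h.side_eq_of_sep hR he hy hye.symm heσ
    -- A common chord would have both regions on the same side, and both would lie on the side of
    -- every other chord on which that common chord lies. They would then coincide.
    have hxy : x ≠ y := by
      rintro rfl
      refine hne (h.region_ext R hR R' hR' fun f hf => ?_)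
      rcases eq_or_ne f x with rfl | hfx
      · exact h1.symm
      · rw [← hx.2 f hf hfx, hy.2 f hf hfx]
    exact ⟨hxy, (hy.2 x hx.1 hxy).trans h1, (hx.2 y hy.1 hxy.symm).trans h2⟩
  have k11 := key d₁ hd₁ hn₁ e₁ he₁ hm₁
  have k12 := key d₁ hd₁ hn₁ e₂ he₂ hm₂
  have k21 := key d₂ hd₂ hn₂ e₁ he₁ hm₁
  have k22 := key d₂ hd₂ hn₂ e₂ he₂ hm₂
  have kd := side_eq_of_bounding hd₁ hd₂ hn
  have kd' := side_eq_of_bounding hd₂ hd₁ hn.symm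
  have ke := side_eq_of_bounding he₁ he₂ hm
  have ke' := side_eq_of_bounding he₂ he₁ hm.symm
  refine h4 ![(d₁, !σ R d₁), (d₂, !σ R d₂), (e₁, !σ R' e₁), (e₂, !σ R' e₂)] ?_ ?_
  · intro k; fin_cases k
    exacts [hd₁.1, hd₂.1, he₁.1, he₂.1]
  · intro k l hkl
    fin_cases k <;> fin_cases l <;>
      simp_all [k11.1.symm, k12.1.symm, k21.1.symm, k22.1.symm, hn.symm, hm.symm]

/-- Two chords bound a common region that is bounded by exactly two chords. -/
def Linked (D : Set E) (𝓡 : Set ρ) (s : E → E → Bool) (σ : ρ → E → Bool) (d e : E) : Prop :=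
  ∃ R, (R ∈ 𝓡 ∧ (bounding D s σ R).ncard = 2) ∧ d ∈ bounding D s σ R ∧ e ∈ bounding D s σ R

lemma Linked.symm {d e : E} (h : Linked D 𝓡 s σ d e) : Linked D 𝓡 s σ e d := by
  obtain ⟨R, h1, h2, h3⟩ := h
  exact ⟨R, h1, h3, h2⟩

/-- The classes of chords that are connected by regions bounded by exactly two chords. -/
def cascades (D : Set E) (𝓡 : Set ρ) (s : E → E → Bool) (σ : ρ → E → Bool) : Set (Set E) :=
  {C | ∃ d ∈ D, C = {e | e ∈ D ∧ Relation.ReflTransGen (Linked D 𝓡 s σ) d e}}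

/-- If all regions but possibly `R` are bounded by at most two chords, then every chord is connected
to a chord that bounds `R`. -/
lemma exists_bounding_linked (h : ChordSystem D 𝓡 s σ) {R : ρ} (hR : R ∈ 𝓡)
    (hle : ∀ R' ∈ 𝓡, R' ≠ R → (bounding D s σ R').ncard ≤ 2) (d : E) (hd : d ∈ D) :
    ∃ e ∈ bounding D s σ R, Relation.ReflTransGen (Linked D 𝓡 s σ) d e := by
  induction d using (h.wellFounded_sep hR).induction with
  | _ d ih =>
  by_cases hb : d ∈ bounding D s σ R
  · exact ⟨d, hb, .refl⟩
  -- One step of the walk towards `R`: enter the region next to `d` on the side of `R`, and leave it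
  -- through the chord `e` that faces `R`. That region has the two chords `d` and `e`, hence no
  -- others, and `e` is nearer to `R`.
  · obtain ⟨R', hR', hσ, hadj⟩ := h.exists_adjacent d hd (σ R d)
    have hdR' : d ∈ bounding D s σ R' := ⟨hd, hadj⟩
    have hne : R' ≠ R := by rintro rfl; exact hb hdR'
    obtain ⟨e, he, hesep⟩ := h.exists_bounding_sep hR' hR hne
    have hed : e ≠ d := by rintro rfl; exact hesep hσ.symm
    obtain ⟨f, hf, hef⟩ := ih e ⟨he.1, hd, hed, by rw [hadj e he.1 hed]; exact hesep.symm⟩ he.1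
    refine ⟨f, hf, .head ⟨R', ⟨hR', ?_⟩, hdR', he⟩ hef⟩
    have h1 : 1 < (bounding D s σ R').ncard :=
      (Set.one_lt_ncard (h.finite_bounding R')).2 ⟨e, he, d, hdR', hed⟩
    have h2 := hle R' hR' hne
    omega

lemma reflTransGen_symm {d e : E} (h : Relation.ReflTransGen (Linked D 𝓡 s σ) d e) :
    Relation.ReflTransGen (Linked D 𝓡 s σ) e d := by
  have : Std.Symm (Linked D 𝓡 s σ) := ⟨fun _ _ => Linked.symm⟩
  exact symm h

/-- The chord `d` is on the side of the chord `e` away from `R`, or equal to `e`. -/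
def Beyond (s : E → E → Bool) (σ : ρ → E → Bool) (R : ρ) (e d : E) : Prop := d = e ∨ s e d ≠ σ R e

/-- The pockets that the bounding chords of `R` cut off are disjoint. -/
lemma eq_of_beyond (h : ChordSystem D 𝓡 s σ) {R : ρ} {e f d : E} (he : e ∈ bounding D s σ R)
    (hf : f ∈ bounding D s σ R) (hd : d ∈ D) (h1 : Beyond s σ R e d) (h2 : Beyond s σ R f d) :
    e = f := by
  by_contra hne
  have hef := side_eq_of_bounding he hf hne
  have hfe := side_eq_of_bounding hf he (Ne.symm hne)
  rcases eq_or_ne d e with rfl | hde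
  · exact h2.elim hne fun h2 => h2 hfe
  rcases eq_or_ne d f with rfl | hdf
  · exact h1.elim hde fun h1 => h1 hef
  have h1' := h1.resolve_left hde
  have h2' := h2.resolve_left hdf
  rcases h.near_chord hd he.1 hf.1 hne hde.symm hdf.symm with h3 | h3
  · exact h1' (h3 ▸ hef)
  · exact h2' (h3 ▸ hfe)

/-- A link uses a 2-bounded region, which is not `R` and so lies in one pocket of `R`, together with
all chords that bound it. Chains of links therefore never leave a pocket. -/
lemma beyond_of_reflTransGen (h : ChordSystem D 𝓡 s σ) {R : ρ} (hR : R ∈ 𝓡)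
    (h3 : 3 ≤ (bounding D s σ R).ncard) {e d d' : E} (he : e ∈ bounding D s σ R)
    (hdd' : Relation.ReflTransGen (Linked D 𝓡 s σ) d d') (hb : Beyond s σ R e d) :
    Beyond s σ R e d' := by
  induction hdd' with
  | refl => exact hb
  | @tail x y _ hxy ih =>
    obtain ⟨R', ⟨hR', hcard⟩, hx, hy⟩ := hxy
    have hne : R ≠ R' := by rintro rfl; omega
    obtain ⟨f, hf, hfσ⟩ := h.exists_bounding_sep hR hR' hne
    have key : ∀ z ∈ bounding D s σ R', Beyond s σ R f z := by
      intro z hz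
      by_cases hzf : z = f
      · exact Or.inl hzf
      · right
        rw [hz.2 f hf.1 (Ne.symm hzf)]
        exact hfσ
    rw [h.eq_of_beyond he hf hx.1 ih (key x hx)]
    exact key y hy

lemma eq_of_reflTransGen (h : ChordSystem D 𝓡 s σ) {R : ρ} (hR : R ∈ 𝓡)
    (h3 : 3 ≤ (bounding D s σ R).ncard) {e e' : E} (he : e ∈ bounding D s σ R)
    (he' : e' ∈ bounding D s σ R) (hee' : Relation.ReflTransGen (Linked D 𝓡 s σ) e e') : e = e' :=
  h.eq_of_beyond he he' he'.1 (h.beyond_of_reflTransGen hR h3 he hee' (Or.inl rfl)) (Or.inl rfl)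

lemma cascade_eq {d e : E} (h : Relation.ReflTransGen (Linked D 𝓡 s σ) d e) :
    {f | f ∈ D ∧ Relation.ReflTransGen (Linked D 𝓡 s σ) d f} =
      {f | f ∈ D ∧ Relation.ReflTransGen (Linked D 𝓡 s σ) e f} := by
  ext f
  exact and_congr_right fun _ => ⟨fun h' => (reflTransGen_symm h).trans h', fun h' => h.trans h'⟩

/-- The structure of the cascades of a system of chords, no four of which are pairwise opposite. -/
theorem cascades_dichotomy (h : ChordSystem D 𝓡 s σ) (h4 : NoFourOpposite D s) :
    ((cascades D 𝓡 s σ).ncard ≤ 1 ∧ ∀ R ∈ 𝓡, (bounding D s σ R).ncard ≤ 2) ∨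
    ((cascades D 𝓡 s σ).ncard = 3 ∧ ∃ R, (R ∈ 𝓡 ∧ (bounding D s σ R).ncard = 3) ∧
      (∀ R' ∈ 𝓡, R' ≠ R → (bounding D s σ R').ncard ≤ 2) ∧
      ∀ C ∈ cascades D 𝓡 s σ, ∃! d, d ∈ C ∧ d ∈ bounding D s σ R) := by
  by_cases hle : ∀ R ∈ 𝓡, (bounding D s σ R).ncard ≤ 2
  · refine Or.inl ⟨?_, hle⟩
    have hfin : (cascades D 𝓡 s σ).Finite := by
      refine (h.finite.image
        fun d => {e | e ∈ D ∧ Relation.ReflTransGen (Linked D 𝓡 s σ) d e}).subset ?_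
      rintro _ ⟨d, hd, rfl⟩
      exact ⟨d, hd, rfl⟩
    rw [Set.ncard_le_one hfin]
    rintro _ ⟨d, hd, rfl⟩ _ ⟨d', hd', rfl⟩
    -- Any region serves as the centre: all chords are connected to its at most two bounding chords,
    -- and if there are two of them, the region links them.
    obtain ⟨R, hR, -⟩ := h.exists_adjacent d hd true
    obtain ⟨e, he, hde⟩ := h.exists_bounding_linked hR (fun R' hR' _ => hle R' hR') d hd
    obtain ⟨e', he', hde'⟩ := h.exists_bounding_linked hR (fun R' hR' _ => hle R' hR') d' hd'
    refine cascade_eq (hde.trans (Relation.ReflTransGen.trans ?_ (reflTransGen_symm hde')))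
    rcases eq_or_ne e e' with rfl | hee'
    · exact .refl
    · refine .single ⟨R, ⟨hR, ?_⟩, he, he'⟩
      have h1 : 1 < (bounding D s σ R).ncard :=
        (Set.one_lt_ncard (h.finite_bounding R)).2 ⟨e, he, e', he', hee'⟩
      have h2 := hle R hR
      omega
  · push Not at hle
    obtain ⟨R, hR, h3⟩ := hle
    have hcard : (bounding D s σ R).ncard = 3 := le_antisymm (h.ncard_bounding_le h4 R) h3
    have hother : ∀ R' ∈ 𝓡, R' ≠ R → (bounding D s σ R').ncard ≤ 2 := by
      intro R' hR' hne
      by_contra! h3'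
      exact hne (h.eq_of_three_le h4 hR' hR h3' h3)
    refine Or.inr ⟨?_, R, ⟨hR, hcard⟩, hother, ?_⟩
    · have himage : cascades D 𝓡 s σ =
          (fun d => {e | e ∈ D ∧ Relation.ReflTransGen (Linked D 𝓡 s σ) d e}) ''
            bounding D s σ R := by
        ext C
        constructor
        · rintro ⟨d, hd, rfl⟩
          obtain ⟨e, he, hde⟩ := h.exists_bounding_linked hR hother d hd
          exact ⟨e, he, (cascade_eq hde).symm⟩
        · rintro ⟨d, hd, rfl⟩
          exact ⟨d, hd.1, rfl⟩
      rw [himage, Set.InjOn.ncard_image, hcard]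
      intro e he e' he' hee'
      have : e' ∈ {f | f ∈ D ∧ Relation.ReflTransGen (Linked D 𝓡 s σ) e f} := by
        simp only at hee'
        rw [hee']
        exact ⟨he'.1, .refl⟩
      exact h.eq_of_reflTransGen hR h3 he he' this.2
    · rintro _ ⟨d, hd, rfl⟩
      obtain ⟨e, he, hde⟩ := h.exists_bounding_linked hR hother d hd
      refine ⟨e, ⟨⟨he.1, hde⟩, he⟩, fun e' he' => ?_⟩
      exact (h.eq_of_reflTransGen hR h3 he he'.2 ((reflTransGen_symm hde).trans he'.1.2)).symm

end ChordSystem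

/-! ### Sign functions of chords in the polygon -/

lemma interior_convexHull_nonempty_of_cr_ne_zero {S : Set ℂ} {a b c : ℂ} (ha : a ∈ S) (hb : b ∈ S)
    (hc : c ∈ S) (h : cr a b c ≠ 0) : (interior (convexHull ℝ S)).Nonempty := by
  have hind : AffineIndependent ℝ ![a, b, c] := by
    rw [affineIndependent_iff_not_collinear_set]
    intro hcol
    obtain ⟨w, hw⟩ := (collinear_iff_of_mem (p₀ := a) (by simp)).1 hcol
    obtain ⟨r, hr⟩ := hw b (by simp)
    obtain ⟨t, ht⟩ := hw c (by simp)
    refine h ?_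
    rw [hr, ht]
    simp [cr]
    ring
  have htop : affineSpan ℝ (Set.range ![a, b, c]) = ⊤ := by
    rw [hind.affineSpan_eq_top_iff_card_eq_finrank_add_one]
    simp [Complex.finrank_real_complex]
  rw [interior_convexHull_nonempty_iff_affineSpan_eq_top, eq_top_iff, ← htop]
  refine affineSpan_mono ℝ ?_
  rintro _ ⟨k, rfl⟩
  fin_cases k
  exacts [ha, hb, hc]

lemma exists_eq_add_smul_of_cr_eq_zero {a b x : ℂ} (hab : a ≠ b) (h : cr a b x = 0) :
    ∃ s t : ℝ, s + t = 1 ∧ x = s • a + t • b := by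
  have hpos : 0 < (b - a).re * (b - a).re + (b - a).im * (b - a).im := by
    rw [← Complex.normSq_apply]; exact Complex.normSq_pos.2 (sub_ne_zero.2 hab.symm)
  set n := (b - a).re * (b - a).re + (b - a).im * (b - a).im with hn
  -- The coordinate of the orthogonal projection of `x` to the line through `a` and `b`.
  set t := ((x - a).re * (b - a).re + (x - a).im * (b - a).im) / n with ht
  have htn : t * n = (x - a).re * (b - a).re + (x - a).im * (b - a).im := by
    rw [ht]; field_simp
  have hre : n * ((x - a).re - t * (b - a).re) = 0 := by
    have : n * ((x - a).re - t * (b - a).re) = -(b - a).im * cr a b x := by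
      rw [mul_sub, ← mul_assoc, mul_comm n t, htn, hn, cr]; ring
    rw [this, h, mul_zero]
  have him : n * ((x - a).im - t * (b - a).im) = 0 := by
    have : n * ((x - a).im - t * (b - a).im) = (b - a).re * cr a b x := by
      rw [mul_sub, ← mul_assoc, mul_comm n t, htn, hn, cr]; ring
    rw [this, h, mul_zero]
  have hre' := (mul_eq_zero.1 hre).resolve_left hpos.ne'
  have him' := (mul_eq_zero.1 him).resolve_left hpos.ne'
  refine ⟨1 - t, t, by ring, ?_⟩
  clear_value t n
  apply Complex.ext
  · simp only [Complex.sub_re] at hre'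
    simp only [Complex.add_re, Complex.real_smul, Complex.re_ofReal_mul]
    linarith
  · simp only [Complex.sub_im] at him'
    simp only [Complex.add_im, Complex.real_smul, Complex.im_ofReal_mul]
    linarith

section Polygon

variable {N : ℕ} [NeZero N] {v : ZMod N → ℂ} {c : ZMod N → Bool}

lemma cr_side_pos (hv : IsConvexPolygon v) (hN : 2 ≤ N) {i m : ZMod N} (h1 : m ≠ i)
    (h2 : m ≠ i + 1) : 0 < cr (v i) (v (i + 1)) (v m) := by
  have : Fact (1 < N) := ⟨hN⟩
  refine cr_pos_of_lt_val hv (by simp) ?_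
  have h3 := val_pos_of_ne h1
  have h4 : (m - i).val ≠ (i + 1 - i).val := fun h => h2 (val_sub_inj h)
  rw [add_sub_cancel_left, ZMod.val_one] at *
  omega

lemma cr_side_nonneg (hv : IsConvexPolygon v) (hN : 2 ≤ N) (i m : ZMod N) :
    0 ≤ cr (v i) (v (i + 1)) (v m) := by
  by_cases h1 : m = i
  · rw [h1, cr_left]
  by_cases h2 : m = i + 1
  · rw [h2, cr_right]
  exact (cr_side_pos hv hN h1 h2).le

/-- An affine function that vanishes at the vertex `j` and is positive at all other vertices. -/
def support (v : ZMod N → ℂ) (j : ZMod N) (x : ℂ) : ℝ :=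
  cr (v (j - 1)) (v (j - 1 + 1)) x + cr (v j) (v (j + 1)) x

lemma support_self (j : ZMod N) : support v j (v j) = 0 := by
  simp [support]

lemma support_pos (hv : IsConvexPolygon v) (hN : 3 ≤ N) {j m : ZMod N} (h : m ≠ j) :
    0 < support v j (v m) := by
  have h1 := cr_side_nonneg hv (by omega) (j - 1) m
  have h2 := cr_side_nonneg hv (by omega) j m
  by_cases hm : m = j + 1
  · have := cr_side_pos hv (by omega) (i := j - 1) (m := m) ?_ (by simpa using h)
    · unfold support; linarith
    · rw [hm]
      intro h3
      have h4 : ((2 : ℕ) : ZMod N) = 0 := by push_cast; linear_combination h3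
      have h5 := congrArg ZMod.val h4
      rw [ZMod.val_natCast_of_lt (by omega), ZMod.val_zero] at h5
      omega
  · have := cr_side_pos hv (by omega) h hm
    unfold support; linarith

lemma support_nonneg (hv : IsConvexPolygon v) (hN : 3 ≤ N) (j : ZMod N) {x : ℂ}
    (hx : x ∈ convexHull ℝ (Set.range v)) : 0 ≤ support v j x := by
  have h1 := convexHull_min (𝕜 := ℝ) (s := Set.range v)
    (t := {x | 0 ≤ cr (v (j - 1)) (v (j - 1 + 1)) x})
    (by rintro _ ⟨m, rfl⟩; exact cr_side_nonneg hv (by omega) _ _) (convex_cr_nonneg _ _) hx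
  have h2 := convexHull_min (𝕜 := ℝ) (s := Set.range v)
    (t := {x | 0 ≤ cr (v j) (v (j + 1)) x})
    (by rintro _ ⟨m, rfl⟩; exact cr_side_nonneg hv (by omega) _ _) (convex_cr_nonneg _ _) hx
  exact add_nonneg h1 h2

/-- A line through two vertices meets the polygon in the segment between them. -/
lemma mem_segment_of_cr_eq_zero (hv : IsConvexPolygon v) (hN : 3 ≤ N) {i j : ZMod N} (hij : i ≠ j)
    {x : ℂ} (hx : x ∈ convexHull ℝ (Set.range v)) (h : cr (v i) (v j) x = 0) :
    x ∈ segment ℝ (v i) (v j) := by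
  obtain ⟨s, t, hst, rfl⟩ := exists_eq_add_smul_of_cr_eq_zero (hv.injective.ne hij) h
  -- At `x`, the affine function `support v j` is `s` times a positive number and is nonnegative on
  -- the polygon, so `s ≥ 0`; likewise for `t` with `support v i`.
  have hlin : ∀ k, support v k (s • v i + t • v j) =
      s * support v k (v i) + t * support v k (v j) := by
    intro k
    rw [support, cr_comb _ _ _ _ hst, cr_comb _ _ _ _ hst, support, support]; ring
  refine ⟨s, t, ?_, ?_, hst, rfl⟩
  · have h1 := support_nonneg hv hN j hx
    rw [hlin, support_self, mul_zero, add_zero] at h1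
    exact nonneg_of_mul_nonneg_left h1 (support_pos hv hN hij)
  · have h1 := support_nonneg hv hN i hx
    rw [hlin, support_self, mul_zero, zero_add] at h1
    exact nonneg_of_mul_nonneg_left h1 (support_pos hv hN hij.symm)

/-- The two points of an unordered pair, in some order. -/
def ends (e : Sym2 (ZMod N)) : ZMod N × ZMod N :=
  Classical.choose (show ∃ p : ZMod N × ZMod N, e = s(p.1, p.2) from
    e.ind fun a b => ⟨(a, b), rfl⟩)

lemma ends_spec (e : Sym2 (ZMod N)) : e = s((ends e).1, (ends e).2) :=
  Classical.choose_spec (show ∃ p : ZMod N × ZMod N, e = s(p.1, p.2) from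
    e.ind fun a b => ⟨(a, b), rfl⟩)

/-- An affine function that vanishes on the pair `e`. -/
def chordFun (v : ZMod N → ℂ) (e : Sym2 (ZMod N)) (x : ℂ) : ℝ :=
  cr (v (ends e).1) (v (ends e).2) x

/-- The side of the chord `e` on which the chord `d` lies. -/
def chordSide (v : ZMod N → ℂ) (e d : Sym2 (ZMod N)) : Bool :=
  decide (0 < chordFun v e (v (ends d).1))

/-- The side of the chord `e` on which the region `R` lies. -/
def regionSide (v : ZMod N → ℂ) (R : Set ℂ) (e : Sym2 (ZMod N)) : Bool :=
  open Classical in decide (∃ x ∈ R, 0 < chordFun v e x)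

lemma seg_eq (v : ZMod N → ℂ) (e : Sym2 (ZMod N)) :
    seg v e = segment ℝ (v (ends e).1) (v (ends e).2) := by
  conv_lhs => rw [ends_spec e]
  rfl

lemma chordFun_eq_zero {e : Sym2 (ZMod N)} {x : ℂ} (hx : x ∈ seg v e) : chordFun v e x = 0 :=
  cr_eq_zero_of_mem_segment (seg_eq v e ▸ hx)

lemma seg_subset (v : ZMod N → ℂ) (e : Sym2 (ZMod N)) : seg v e ⊆ convexHull ℝ (Set.range v) := by
  rw [seg_eq]
  exact (convex_convexHull ℝ _).segment_subset (subset_convexHull ℝ _ ⟨_, rfl⟩)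
    (subset_convexHull ℝ _ ⟨_, rfl⟩)

lemma left_mem_seg (v : ZMod N → ℂ) (e : Sym2 (ZMod N)) : v (ends e).1 ∈ seg v e := by
  rw [seg_eq]; exact left_mem_segment ℝ _ _

lemma chordFun_comb (e : Sym2 (ZMod N)) (x y : ℂ) {s t : ℝ} (h : s + t = 1) :
    chordFun v e (s • x + t • y) = s * chordFun v e x + t * chordFun v e y :=
  cr_comb _ _ _ _ h

lemma continuous_chordFun (e : Sym2 (ZMod N)) : Continuous (chordFun v e) := continuous_cr _ _

namespace Matching

variable {M : Matching v c}

lemma ends_of_mem {e : Sym2 (ZMod N)} (he : e ∈ M.diagonals) :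
    M.partner (ends e).1 = (ends e).2 ∧ IsDiagonal v c (ends e).1 (ends e).2 := by
  obtain ⟨i, hi, hei⟩ := he
  rw [ends_spec e, Sym2.eq_iff] at hei
  rcases hei with ⟨h1, h2⟩ | ⟨h1, h2⟩
  · rw [h1, h2]; exact ⟨rfl, hi⟩
  · rw [h1, h2]; exact ⟨M.partner_partner i, hi.symm⟩

lemma ends_ne {e : Sym2 (ZMod N)} (he : e ∈ M.diagonals) : (ends e).1 ≠ (ends e).2 := by
  rw [← (ends_of_mem he).1]; exact (M.partner_ne _).symm

/-- The two ends of a pair lie on the same side of another pair. -/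
lemma cr_partner_pos_iff (hv : IsConvexPolygon v) {i x : ZMod N} (h1 : x ≠ i)
    (h2 : x ≠ M.partner i) : 0 < cr (v i) (v (M.partner i)) (v (M.partner x)) ↔
      0 < cr (v i) (v (M.partner i)) (v x) := by
  have key : ∀ y, y ≠ i → y ≠ M.partner i →
      (0 < cr (v i) (v (M.partner i)) (v y) ↔ (M.partner i - i).val < (y - i).val) := by
    intro y hy1 hy2
    refine ⟨fun h => ?_, cr_pos_of_lt_val hv (M.partner_ne i)⟩
    by_contra! h3
    have h4 : (y - i).val ≠ (M.partner i - i).val := fun h => hy2 (val_sub_inj h)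
    linarith [cr_neg_of_val_lt hv hy1 (lt_of_le_of_ne h3 h4)]
  have h3 : M.partner x ≠ i := fun h => h2 (by rw [← h, M.partner_partner])
  have h4 : M.partner x ≠ M.partner i := fun h =>
    h1 (by rw [← M.partner_partner x, h, M.partner_partner])
  rw [key _ h3 h4, key _ h1 h2, ← not_le, ← not_le, not_iff_not]
  refine ⟨fun h => ?_, M.val_partner_le hv⟩
  have := M.val_partner_le hv h
  rwa [M.partner_partner] at this

lemma left_ne {d e : Sym2 (ZMod N)} (hd : d ∈ M.diagonals) (he : e ∈ M.diagonals) (hne : d ≠ e) :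
    (ends d).1 ≠ (ends e).1 ∧ (ends d).1 ≠ (ends e).2 := by
  constructor
  · intro h
    apply hne
    rw [ends_spec d, ends_spec e, ← (ends_of_mem hd).1, ← (ends_of_mem he).1, h]
  · intro h
    apply hne
    rw [ends_spec d, ends_spec e, ← (ends_of_mem hd).1, h, ← (ends_of_mem he).1,
      M.partner_partner, Sym2.eq_swap]

lemma right_ne {d e : Sym2 (ZMod N)} (hd : d ∈ M.diagonals) (he : e ∈ M.diagonals) (hne : d ≠ e) :
    (ends d).2 ≠ (ends e).1 ∧ (ends d).2 ≠ (ends e).2 := by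
  have hd' := (ends_of_mem hd).1
  have he' := (ends_of_mem he).1
  have h := left_ne hd he hne
  constructor
  · intro h'
    exact h.2 (by rw [← he', ← h', ← hd', M.partner_partner])
  · intro h'
    exact h.1 (by rw [← M.partner_partner (ends d).1, hd', h', ← he', M.partner_partner])

lemma chordFun_right_pos_iff (hv : IsConvexPolygon v) {d e : Sym2 (ZMod N)}
    (hd : d ∈ M.diagonals) (he : e ∈ M.diagonals) (hne : d ≠ e) :
    0 < chordFun v e (v (ends d).2) ↔ 0 < chordFun v e (v (ends d).1) := by
  have h := left_ne hd he hne
  rw [← (ends_of_mem he).1] at h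
  rw [chordFun, chordFun, ← (ends_of_mem he).1, ← (ends_of_mem hd).1]
  exact M.cr_partner_pos_iff hv h.1 h.2

/-- Both ends of `d` lie strictly on the same side of `e`, and open half-planes are convex. This is
why `chordSide` may look at one end only. -/
lemma chordFun_sign (hv : IsConvexPolygon v) {d e : Sym2 (ZMod N)} (hd : d ∈ M.diagonals)
    (he : e ∈ M.diagonals) (hne : d ≠ e) {x : ℂ} (hx : x ∈ seg v d) :
    chordFun v e x ≠ 0 ∧ (0 < chordFun v e x ↔ chordSide v e d = true) := by
  have h1 : chordFun v e (v (ends d).1) ≠ 0 :=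
    cr_ne_zero hv (ends_ne he).symm (left_ne hd he hne).1 (left_ne hd he hne).2
  have h2 : chordFun v e (v (ends d).2) ≠ 0 :=
    cr_ne_zero hv (ends_ne he).symm (right_ne hd he hne).1 (right_ne hd he hne).2
  have h3 := chordFun_right_pos_iff hv hd he hne
  rw [seg_eq] at hx
  rw [chordSide, decide_eq_true_iff]
  by_cases hpos : 0 < chordFun v e (v (ends d).1)
  · have := (convex_cr_pos _ _).segment_subset hpos (h3.2 hpos) hx
    exact ⟨ne_of_gt this, iff_of_true this hpos⟩
  · have := (convex_cr_neg _ _).segment_subset (lt_of_le_of_ne (not_lt.1 hpos) h1)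
      (lt_of_le_of_ne (not_lt.1 (mt h3.1 hpos)) h2) hx
    exact ⟨ne_of_lt this, iff_of_false (not_lt.2 (le_of_lt this)) hpos⟩

end Matching

end Polygon

open ChordSystem

/-! ### Regions as convex cells; the chord system of a matching -/

section Polygon

variable {N : ℕ} [NeZero N] {v : ZMod N → ℂ} {c : ZMod N → Bool}

namespace Matching

variable {M : Matching v c}

/-- The points of the interior of the polygon on the same side of each diagonal as `x`. -/
def cell (M : Matching v c) (x : ℂ) : Set ℂ :=
  {y | y ∈ interior (convexHull ℝ (Set.range v)) ∧
    ∀ e ∈ M.diagonals, chordFun v e y ≠ 0 ∧ (0 < chordFun v e y ↔ 0 < chordFun v e x)}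

/-- Within the polygon, the line through a diagonal is no more than its segment, so removing the
segments amounts to sign conditions. -/
lemma mem_cutInterior_iff (hv : IsConvexPolygon v) (hN : 3 ≤ N) {x : ℂ} :
    x ∈ M.cutInterior ↔ x ∈ interior (convexHull ℝ (Set.range v)) ∧
      ∀ e ∈ M.diagonals, chordFun v e x ≠ 0 := by
  simp only [cutInterior, Set.mem_sdiff, Set.mem_iUnion, not_exists]
  refine and_congr_right fun hx => forall₂_congr fun e he => not_congr ⟨chordFun_eq_zero, fun h => ?_⟩
  rw [seg_eq]
  exact mem_segment_of_cr_eq_zero hv hN (ends_ne he) (interior_subset hx) h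

lemma convex_cell (M : Matching v c) (x : ℂ) : Convex ℝ (M.cell x) := by
  intro y hy z hz s t hs ht hst
  refine ⟨(convex_convexHull ℝ _).interior hy.1 hz.1 hs ht hst, fun e he => ?_⟩
  obtain ⟨hy1, hy2⟩ := hy.2 e he
  obtain ⟨hz1, hz2⟩ := hz.2 e he
  by_cases hpos : 0 < chordFun v e x
  · have := convex_cr_pos (v (ends e).1) (v (ends e).2) (hy2.2 hpos) (hz2.2 hpos) hs ht hst
    exact ⟨ne_of_gt this, iff_of_true this hpos⟩
  · have := convex_cr_neg (v (ends e).1) (v (ends e).2)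
      (lt_of_le_of_ne (not_lt.1 (mt hy2.1 hpos)) hy1)
      (lt_of_le_of_ne (not_lt.1 (mt hz2.1 hpos)) hz1) hs ht hst
    exact ⟨ne_of_lt this, iff_of_false (not_lt.2 (le_of_lt this)) hpos⟩

/-- By the intermediate value theorem no sign changes within a component; conversely a cell is
convex, hence connected. -/
lemma connectedComponentIn_eq_cell (hv : IsConvexPolygon v) (hN : 3 ≤ N) {x : ℂ}
    (hx : x ∈ M.cutInterior) : connectedComponentIn M.cutInterior x = M.cell x := by
  have hx' := (mem_cutInterior_iff hv hN).1 hx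
  apply Set.Subset.antisymm
  · intro y hy
    have hsub := connectedComponentIn_subset M.cutInterior x
    refine ⟨((mem_cutInterior_iff hv hN).1 (hsub hy)).1, fun e he => ?_⟩
    have hne : ∀ z ∈ connectedComponentIn M.cutInterior x, chordFun v e z ≠ 0 := fun z hz =>
      ((mem_cutInterior_iff hv hN).1 (hsub hz)).2 e he
    have key : ∀ a ∈ connectedComponentIn M.cutInterior x,
        ∀ b ∈ connectedComponentIn M.cutInterior x, 0 < chordFun v e a → 0 < chordFun v e b := by
      intro a ha b hb hpos
      by_contra! hneg
      obtain ⟨z, hz, hz0⟩ := isPreconnected_connectedComponentIn.intermediate_value hb ha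
        (continuous_chordFun e).continuousOn ⟨hneg, hpos.le⟩
      exact hne z hz hz0
    have hxx := mem_connectedComponentIn hx
    exact ⟨hne y hy, key y hy x hxx, key x hxx y hy⟩
  · refine (M.convex_cell x).isPreconnected.subset_connectedComponentIn
      ⟨hx'.1, fun e he => ⟨hx'.2 e he, Iff.rfl⟩⟩ fun y hy => ?_
    exact (mem_cutInterior_iff hv hN).2 ⟨hy.1, fun e he => (hy.2 e he).1⟩

lemma cell_eq_of_mem {x y : ℂ} (hy : y ∈ M.cell x) : M.cell x = M.cell y := by
  ext z
  refine and_congr_right fun _ => forall₂_congr fun e he => and_congr_right fun _ => ?_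
  rw [(hy.2 e he).2]

/-- A region is the cell of each of its points. -/
lemma exists_eq_cell (hv : IsConvexPolygon v) (hN : 3 ≤ N) {R : Set ℂ} (hR : R ∈ M.regions) :
    ∃ x ∈ M.cutInterior, x ∈ R ∧ R = M.cell x := by
  obtain ⟨x, hx, rfl⟩ := hR
  exact ⟨x, hx, mem_connectedComponentIn hx, connectedComponentIn_eq_cell hv hN hx⟩

lemma regionSide_eq_true_iff {x y : ℂ} {e : Sym2 (ZMod N)} (he : e ∈ M.diagonals)
    (hx : x ∈ M.cell x) (hy : y ∈ M.cell x) :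
    regionSide v (M.cell x) e = true ↔ 0 < chordFun v e y := by
  simp only [regionSide, decide_eq_true_eq]
  rw [(hy.2 e he).2]
  exact ⟨fun ⟨z, hz, hpos⟩ => ((hz.2 e he).2).1 hpos, fun h => ⟨x, hx, h⟩⟩

/-- This translates the topological boundary into sides. Closures stay in closed half-planes, which
gives one inclusion; for the other, a point of `d` is approached from inside the cell along a
segment. -/
lemma boundingDiagonals_eq (hv : IsConvexPolygon v) (hN : 3 ≤ N) {R : Set ℂ}
    (hR : R ∈ M.regions) :
    M.boundingDiagonals R = bounding M.diagonals (chordSide v) (regionSide v) R := by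
  obtain ⟨x, hx, hxR, rfl⟩ := exists_eq_cell hv hN hR
  have hx' := (mem_cutInterior_iff hv hN).1 hx
  ext d
  refine and_congr_right fun hd => ⟨fun h e he hed => ?_, fun h p hp => ?_⟩
  · have hp := frontier_subset_closure (h (left_mem_seg v d))
    obtain ⟨hne, hsign⟩ := chordFun_sign hv hd he (Ne.symm hed) (left_mem_seg v d)
    rw [Bool.eq_iff_iff, ← hsign, regionSide_eq_true_iff he hxR hxR]
    constructor
    · intro hpos
      by_contra hneg
      have : closure (M.cell x) ⊆ {y | chordFun v e y ≤ 0} :=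
        closure_minimal (fun y hy => not_lt.1 (mt (hy.2 e he).2.1 hneg))
          (isClosed_le (continuous_chordFun e) continuous_const)
      exact absurd (this hp) (not_le.2 hpos)
    · intro hpos
      have : closure (M.cell x) ⊆ {y | 0 ≤ chordFun v e y} :=
        closure_minimal (fun y hy => ((hy.2 e he).2.2 hpos).le)
          (isClosed_le continuous_const (continuous_chordFun e))
      exact lt_of_le_of_ne (this hp) hne.symm
  · refine ⟨?_, fun hint => ((interior_subset hint).2 d hd).1 (chordFun_eq_zero hp)⟩
    refine closure_mono ?_ (segment_subset_closure_openSegment (left_mem_segment ℝ p x))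
    intro y hy
    refine ⟨(convex_convexHull ℝ _).openSegment_self_interior_subset_interior
      (seg_subset v d hp) hx'.1 hy, fun e he => ?_⟩
    obtain ⟨s, t, hs, ht, hst, rfl⟩ := hy
    have hxe := hx'.2 e he
    rw [chordFun_comb _ _ _ hst]
    rcases eq_or_ne e d with rfl | hed
    · rw [chordFun_eq_zero hp, mul_zero, zero_add]
      exact ⟨mul_ne_zero ht.ne' hxe, by rw [mul_pos_iff_of_pos_left ht]⟩
    · obtain ⟨hne, hsign⟩ := chordFun_sign hv hd he (Ne.symm hed) hp
      rw [h e he hed, regionSide_eq_true_iff he hxR hxR] at hsign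
      by_cases hpos : 0 < chordFun v e x
      · have := add_pos (mul_pos hs (hsign.2 hpos)) (mul_pos ht hpos)
        exact ⟨this.ne', iff_of_true this hpos⟩
      · have h1 : chordFun v e p < 0 := lt_of_le_of_ne (not_lt.1 (mt hsign.1 hpos)) hne
        have h2 : chordFun v e x < 0 := lt_of_le_of_ne (not_lt.1 hpos) hxe
        have := add_neg (mul_neg_of_pos_of_neg hs h1) (mul_neg_of_pos_of_neg ht h2)
        exact ⟨this.ne, iff_of_false this.not_gt hpos⟩

/-- The chord `e` cannot be beyond `d`, and `d` beyond `e`, as seen from a region. -/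
lemma chordSide_eq_or (hv : IsConvexPolygon v) (hN : 3 ≤ N) {R : Set ℂ} (hR : R ∈ M.regions)
    {d e : Sym2 (ZMod N)} (hd : d ∈ M.diagonals) (he : e ∈ M.diagonals) (hne : d ≠ e) :
    chordSide v d e = regionSide v R d ∨ chordSide v e d = regionSide v R e := by
  obtain ⟨x, hx, hxR, rfl⟩ := exists_eq_cell hv hN hR
  have hx' := (mem_cutInterior_iff hv hN).1 hx
  by_contra! hcon
  obtain ⟨h1, h2⟩ := hcon
  set p := v (ends d).1 with hp
  have hpd : p ∈ seg v d := left_mem_seg v d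
  obtain ⟨hpe, hsign⟩ := chordFun_sign hv hd he hne hpd
  have hxe := hx'.2 e he
  rw [Ne, Bool.eq_iff_iff, ← hsign, regionSide_eq_true_iff he hxR hxR] at h2
  rw [Ne, Bool.eq_iff_iff, regionSide_eq_true_iff hd hxR hxR] at h1
  -- As `x` and the end `p` of `d` lie on different sides of `e`, the segment between them meets
  -- `e`. The meeting point lies on the same side of `d` as `x`, and therefore so does `e`.
  obtain ⟨s, t, hs, ht, hst, hzero⟩ : ∃ s t : ℝ, 0 < s ∧ 0 < t ∧ s + t = 1 ∧
      s * chordFun v e x + t * chordFun v e p = 0 := by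
    rcases lt_or_gt_of_ne hpe with hpe | hpe
    · have hxe : 0 < chordFun v e x := by
        by_contra h; exact h2 (iff_of_false hpe.not_gt h)
      have : 0 < chordFun v e x - chordFun v e p := by linarith
      refine ⟨-chordFun v e p / (chordFun v e x - chordFun v e p),
        chordFun v e x / (chordFun v e x - chordFun v e p),
        div_pos (by linarith) this, div_pos hxe this, ?_, ?_⟩ <;> field_simp <;> ring
    · have hxe : chordFun v e x < 0 := by
        refine lt_of_le_of_ne (not_lt.1 fun h => h2 (iff_of_true hpe h)) hxe
      have : 0 < chordFun v e p - chordFun v e x := by linarith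
      refine ⟨chordFun v e p / (chordFun v e p - chordFun v e x),
        -chordFun v e x / (chordFun v e p - chordFun v e x),
        div_pos hpe this, div_pos (by linarith) this, ?_, ?_⟩ <;> field_simp <;> ring
  have hq : s • x + t • p ∈ seg v e := by
    rw [seg_eq]
    refine mem_segment_of_cr_eq_zero hv hN (ends_ne he) ?_ ?_
    · exact convex_convexHull ℝ _ (interior_subset hx'.1) (seg_subset v d hpd) hs.le ht.le hst
    · exact (chordFun_comb e x p hst).trans hzero
  obtain ⟨-, hsign'⟩ := chordFun_sign hv he hd hne.symm hq
  rw [chordFun_comb _ _ _ hst, chordFun_eq_zero hpd, mul_zero, add_zero,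
    mul_pos_iff_of_pos_left hs] at hsign'
  exact h1 hsign'.symm

lemma exists_vertex (hv : IsConvexPolygon v) (hN : 3 ≤ N) {d : Sym2 (ZMod N)}
    (h1 : (ends d).2 ≠ (ends d).1 + 1) (h2 : (ends d).1 ≠ (ends d).2 + 1)
    (h3 : (ends d).1 ≠ (ends d).2) (b : Bool) :
    ∃ m, chordFun v d (v m) ≠ 0 ∧ (0 < chordFun v d (v m) ↔ b = true) := by
  have : Fact (1 < N) := ⟨by omega⟩
  have hval : ∀ i j : ZMod N, j ≠ i → j ≠ i + 1 → cr (v i) (v j) (v (i + 1)) < 0 := by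
    intro i j hj1 hj2
    refine cr_neg_of_val_lt hv (by simp) ?_
    have h4 := val_pos_of_ne hj1
    have h5 : (j - i).val ≠ (i + 1 - i).val := fun h => hj2 (val_sub_inj h)
    rw [add_sub_cancel_left, ZMod.val_one] at *
    omega
  cases b with
  | false =>
    have := hval (ends d).1 (ends d).2 h3.symm h1
    exact ⟨_, ne_of_lt this, iff_of_false (lt_asymm this) (by simp)⟩
  | true =>
    have := hval (ends d).2 (ends d).1 h3 h2
    rw [cr_swap, neg_lt_zero] at this
    exact ⟨_, ne_of_gt this, iff_of_true this rfl⟩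

/-- On each side of a diagonal there is a region that it bounds. -/
lemma exists_adjacent_region (hv : IsConvexPolygon v) (hN : 3 ≤ N) {d : Sym2 (ZMod N)}
    (hd : d ∈ M.diagonals) (h1 : (ends d).2 ≠ (ends d).1 + 1) (h2 : (ends d).1 ≠ (ends d).2 + 1)
    (b : Bool) : ∃ R ∈ M.regions, regionSide v R d = b ∧
      ∀ e ∈ M.diagonals, e ≠ d → chordSide v e d = regionSide v R e := by
  obtain ⟨m, hm0, hm⟩ := exists_vertex hv hN h1 h2 (ends_ne hd) b
  have hint : (interior (convexHull ℝ (Set.range v))).Nonempty :=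
    interior_convexHull_nonempty_of_cr_ne_zero ⟨_, rfl⟩ ⟨_, rfl⟩ ⟨m, rfl⟩ hm0
  have hopen : ∀ (e : Sym2 (ZMod N)) (x : ℂ), chordFun v e x ≠ 0 →
      ∀ᶠ y in nhds x, chordFun v e y ≠ 0 ∧ (0 < chordFun v e y ↔ 0 < chordFun v e x) := by
    intro e x hx
    rcases lt_or_gt_of_ne hx with h | h
    · filter_upwards [(continuous_chordFun (v := v) e).continuousAt.eventually_lt_const h] with y hy
      exact ⟨hy.ne, iff_of_false hy.not_gt h.not_gt⟩
    · filter_upwards [(continuous_chordFun (v := v) e).continuousAt.eventually_const_lt h] with y hy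
      exact ⟨hy.ne', iff_of_true hy h⟩
  have hmcl : v m ∈ closure (interior (convexHull ℝ (Set.range v))) := by
    rw [(convex_convexHull ℝ _).closure_interior_eq_closure_of_nonempty_interior hint]
    exact subset_closure (subset_convexHull ℝ _ ⟨m, rfl⟩)
  -- An interior point `z` on side `b` of `d`, found near the vertex `v m`. Moving from `z` almost
  -- to the end `p` of `d` stays interior and on side `b`, and reaches the signs that `p` has for
  -- all other diagonals.
  obtain ⟨z, ⟨hz0, hz⟩, hzint⟩ := mem_closure_iff_nhds.1 hmcl _ (hopen d (v m) hm0)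
  have hp := left_mem_seg v d
  set p := v (ends d).1
  have hpcl : p ∈ closure (openSegment ℝ p z) :=
    segment_subset_closure_openSegment (left_mem_segment ℝ p z)
  have hW : ∀ᶠ y in nhds p, ∀ e ∈ {e | e ∈ M.diagonals ∧ e ≠ d},
      chordFun v e y ≠ 0 ∧ (0 < chordFun v e y ↔ 0 < chordFun v e p) := by
    refine (Filter.eventually_all_finite (Set.toFinite _)).2 fun e he => ?_
    exact hopen e p (chordFun_sign hv hd he.1 he.2.symm hp).1
  obtain ⟨y, hyW, hy⟩ := mem_closure_iff_nhds.1 hpcl _ hW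
  have hyint := (convex_convexHull ℝ _).openSegment_self_interior_subset_interior
      (seg_subset v d hp) hzint hy
  have hyd : chordFun v d y ≠ 0 ∧ (0 < chordFun v d y ↔ b = true) := by
    obtain ⟨s, t, hs, ht, hst, rfl⟩ := hy
    rw [chordFun_comb _ _ _ hst, chordFun_eq_zero hp, mul_zero, zero_add,
      mul_pos_iff_of_pos_left ht, hz, hm]
    exact ⟨mul_ne_zero ht.ne' hz0, Iff.rfl⟩
  have hycut : y ∈ M.cutInterior := by
    refine (mem_cutInterior_iff hv hN).2 ⟨hyint, fun e he => ?_⟩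
    rcases eq_or_ne e d with rfl | hed
    · exact hyd.1
    · exact (hyW e ⟨he, hed⟩).1
  have hycell : y ∈ M.cell y :=
    connectedComponentIn_eq_cell hv hN hycut ▸ mem_connectedComponentIn hycut
  refine ⟨M.cell y, ⟨y, hycut, (connectedComponentIn_eq_cell hv hN hycut).symm⟩, ?_, ?_⟩
  · rw [Bool.eq_iff_iff, regionSide_eq_true_iff hd hycell hycell, hyd.2]
  · intro e he hed
    rw [Bool.eq_iff_iff, regionSide_eq_true_iff he hycell hycell, (hyW e ⟨he, hed⟩).2,
      (chordFun_sign hv hd he hed.symm hp).2]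

/-- The diagonals of a matching form a system of chords. -/
lemma chordSystem (hv : IsConvexPolygon v) (hN : 3 ≤ N)
    (h1 : ∀ i, IsDiagonal v c i (M.partner i) → M.partner i ≠ i + 1) :
    ChordSystem M.diagonals M.regions (chordSide v) (regionSide v) where
  finite := Set.toFinite _
  region_ext R hR R' hR' h := by
    obtain ⟨x, hx, hxR, rfl⟩ := exists_eq_cell hv hN hR
    obtain ⟨y, hy, hyR, rfl⟩ := exists_eq_cell hv hN hR'
    refine (cell_eq_of_mem ⟨hyR.1, fun e he => ⟨(hyR.2 e he).1, ?_⟩⟩)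
    have := h e he
    rw [Bool.eq_iff_iff, regionSide_eq_true_iff he hxR hxR,
      regionSide_eq_true_iff he hyR hyR] at this
    exact this.symm
  near R hR d hd e he hne := chordSide_eq_or hv hN hR hd he hne
  exists_adjacent d hd b := by
    obtain ⟨hp, hdiag⟩ := ends_of_mem hd
    refine exists_adjacent_region hv hN hd ?_ ?_ b
    · have := h1 (ends d).1 (by rwa [hp])
      rwa [hp] at this
    · have h := h1 (ends d).2
      rw [← hp, M.partner_partner, hp] at h
      exact h hdiag.symm

/-- The chord of a pair, oriented so that the side `b` is on the right. -/
lemma exists_oriented (hv : IsConvexPolygon v) {d : Sym2 (ZMod N)} (hd : d ∈ M.diagonals)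
    (b : Bool) : ∃ i j, M.partner i = j ∧ IsDiagonal v c i j ∧ d = s(i, j) ∧
      ∀ z, chordFun v d (v z) ≠ 0 → (0 < chordFun v d (v z) ↔ b ≠ true) →
        (j - i).val < (z - i).val := by
  obtain ⟨hp, hdiag⟩ := ends_of_mem hd
  have key : ∀ i j z, 0 < cr (v i) (v j) (v z) → (j - i).val < (z - i).val := by
    intro i j z h
    by_contra! hle
    rcases eq_or_ne z i with rfl | hzi
    · simp at h
    · rcases hle.eq_or_lt with hle | hlt
      · rw [val_sub_inj hle] at h; simp at h
      · exact absurd h (cr_neg_of_val_lt hv hzi hlt).not_gt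
  cases b with
  | false =>
    exact ⟨_, _, hp, hdiag, ends_spec d, fun z _ hz => key _ _ _ (hz.2 (by simp))⟩
  | true =>
    refine ⟨(ends d).2, (ends d).1, by rw [← hp, M.partner_partner], hdiag.symm,
      (ends_spec d).trans Sym2.eq_swap, fun z hz0 hz => key _ _ _ ?_⟩
    rw [cr_swap]
    have : ¬ 0 < chordFun v d (v z) := fun h => hz.1 h rfl
    exact neg_pos.2 (lt_of_le_of_ne (not_lt.1 this) hz0)

/-- Each diagonal is oriented so that its chosen side is its arc. Opposite diagonals then have
disjoint arcs, and `not_four_arcs` applies. -/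
lemma noFourOpposite (hv : IsConvexPolygon v) (hN : 3 ≤ N)
    (hτ : ∀ i, IsDiagonal v c i (M.partner i) → Real.pi / 2 < turningAngle v i (M.partner i)) :
    NoFourOpposite M.diagonals (chordSide v) := by
  intro x hx hopp
  choose i j hp hdiag hd hz using fun k => exists_oriented hv (hx k) (x k).2
  have hmem : ∀ k, v (i k) ∈ seg v (x k).1 ∧ v (j k) ∈ seg v (x k).1 := by
    intro k
    have : seg v (x k).1 = segment ℝ (v (i k)) (v (j k)) := by rw [hd k]; rfl
    rw [this]
    exact ⟨left_mem_segment ℝ _ _, right_mem_segment ℝ _ _⟩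
  have key : ∀ k l, k ≠ l → ∀ z, v z ∈ seg v (x l).1 → (j k - i k).val < (z - i k).val := by
    intro k l hkl z hzl
    obtain ⟨hne, hside⟩ := hopp k l hkl
    obtain ⟨h0, hsign⟩ := chordFun_sign hv (hx l) (hx k) hne.symm hzl
    refine hz k z h0 (hsign.trans ?_)
    revert hside
    cases chordSide v (x k).1 (x l).1 <;> cases (x k).2 <;> simp
  exact not_four_arcs hv hN i j (fun k => by rw [← hp k]; exact (M.partner_ne _).symm)
    (fun k l hkl => key k l hkl _ (hmem l).1) (fun k l hkl => key k l hkl _ (hmem l).2)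
    (fun k => by rw [← hp k]; exact hτ _ (by rw [hp k]; exact hdiag k))

end Matching

end Polygon

/-! ### Transfer of the dichotomy to the polygon -/

section Polygon

variable {N : ℕ} [NeZero N] {v : ZMod N → ℂ} {c : ZMod N → Bool}

/-- Consecutive points never form a diagonal. -/
lemma not_isDiagonal_succ (hv : IsConvexPolygon v) (hN : 2 ≤ N) (i : ZMod N) :
    ¬ IsDiagonal v c i (i + 1) := by
  intro h
  refine h.2 ⟨h.1, Or.inr ?_⟩
  have := o_eq_of_not_balanced (v := v) (c := c) hv i (a := 0) (b := 1) one_pos (by omega)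
    (by simpa using h.1) (by omega)
  simpa using this.symm

namespace Matching

lemma diagonals_eq_empty (M : Matching v c) (hv : IsConvexPolygon v) (hN : N = 2) :
    M.diagonals = ∅ := by
  refine Set.eq_empty_of_forall_notMem ?_
  rintro _ ⟨i, hi, -⟩
  have h1 := val_pos_of_ne (M.partner_ne i)
  have h2 := ZMod.val_lt (M.partner i - i)
  have h3 := add_val_sub i (M.partner i)
  rw [show (M.partner i - i).val = 1 by omega, Nat.cast_one] at h3
  rw [← h3] at hi
  exact not_isDiagonal_succ hv hN.ge i hi

lemma linked_eq {M : Matching v c} (hv : IsConvexPolygon v) (hN : 3 ≤ N) :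
    M.Linked = ChordSystem.Linked M.diagonals M.regions (chordSide v) (regionSide v) := by
  funext d e
  refine propext (exists_congr fun R => ⟨fun ⟨⟨hR, h1⟩, h2⟩ => ?_, fun ⟨⟨hR, h1⟩, h2⟩ => ?_⟩)
  · rw [boundingDiagonals_eq hv hN hR] at h1 h2
    exact ⟨⟨hR, h1⟩, h2⟩
  · rw [← boundingDiagonals_eq hv hN hR] at h1 h2
    exact ⟨⟨hR, h1⟩, h2⟩

lemma cascades_eq {M : Matching v c} (hv : IsConvexPolygon v) (hN : 3 ≤ N) :
    M.cascades = ChordSystem.cascades M.diagonals M.regions (chordSide v) (regionSide v) := by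
  rw [Matching.cascades, linked_eq hv hN]
  rfl

/-- A matching all of whose diagonals have turning angle greater than `π / 2` has at most one
cascade, or three cascades around a region. -/
lemma cascades_of_turningAngle {M : Matching v c} (hv : IsConvexPolygon v) (hN : 2 ≤ N)
    (hτ : ∀ i, IsDiagonal v c i (M.partner i) → Real.pi / 2 < turningAngle v i (M.partner i)) :
    (M.cascades.ncard ≤ 1 ∧ ∀ R ∈ M.regions, (M.boundingDiagonals R).ncard ≤ 2) ∨
      (M.cascades.ncard = 3 ∧ ∃ R, M.IsKBounded 3 R ∧
        (∀ R' ∈ M.regions, R' ≠ R → (M.boundingDiagonals R').ncard ≤ 2) ∧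
        ∀ C ∈ M.cascades, ∃! d, d ∈ C ∧ d ∈ M.boundingDiagonals R) := by
  -- Two points do not span a genuine polygon, so the results on regions need `3 ≤ N`; for `N = 2`
  -- there are no diagonals at all.
  rcases hN.eq_or_lt with hN | hN
  · have hempty := M.diagonals_eq_empty hv hN.symm
    left
    simp [Matching.cascades, Matching.boundingDiagonals, hempty]
  · have hsys := M.chordSystem hv hN fun i hi h =>
      not_isDiagonal_succ (c := c) hv (by omega) i (h ▸ hi)
    have hbd : ∀ R ∈ M.regions, M.boundingDiagonals R =
        bounding M.diagonals (chordSide v) (regionSide v) R := fun R hR =>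
      boundingDiagonals_eq hv hN hR
    rw [cascades_eq hv hN]
    rcases hsys.cascades_dichotomy (noFourOpposite hv hN hτ) with
      ⟨h1, h2⟩ | ⟨h1, R, ⟨hR, h2⟩, h3, h4⟩
    · exact Or.inl ⟨h1, fun R hR => hbd R hR ▸ h2 R hR⟩
    · refine Or.inr ⟨h1, R, ⟨hR, hbd R hR ▸ h2⟩, fun R' hR' hne => hbd R' hR' ▸ h3 R' hR' hne, ?_⟩
      rw [hbd R hR]
      exact h4

end Matching

end Polygon

end Bichromatic

end

theorem mainTheorem8 (n : ℕ) (hn : 1 ≤ n) (v : ZMod (2 * n) → ℂ) (c : ZMod (2 * n) → Bool)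
    (hv : Bichromatic.IsConvexPolygon v) (hc : Bichromatic.IsBalanced c) :
    ∃ M : Bichromatic.Matching v c, M.IsBottleneck ∧
      -- all diagonals, in both orientations, have turning angle greater than `π / 2`
      (∀ i j, M.partner i = j → Bichromatic.IsDiagonal v c i j →
        Real.pi / 2 < Bichromatic.turningAngle v i j) ∧
      M.cascades.ncard ≤ 3 ∧
      -- at most one cascade, and every region is bounded by at most two diagonals, or
      ((M.cascades.ncard ≤ 1 ∧ ∀ R ∈ M.regions, (M.boundingDiagonals R).ncard ≤ 2) ∨
      -- exactly three cascades, around the only region bounded by more than two diagonals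
        (M.cascades.ncard = 3 ∧ ∃ R, M.IsKBounded 3 R ∧
          (∀ R' ∈ M.regions, R' ≠ R → (M.boundingDiagonals R').ncard ≤ 2) ∧
          ∀ C ∈ M.cascades, ∃! d, d ∈ C ∧ d ∈ M.boundingDiagonals R)) := by
  have : NeZero (2 * n) := ⟨by omega⟩
  obtain ⟨M, hM, hτ⟩ :=
    Bichromatic.exists_isBottleneck_turningAngle hv (Bichromatic.exists_matching hv hc)
  have h := Bichromatic.Matching.cascades_of_turningAngle hv (by omega) hτ
  refine ⟨M, hM, fun i j hij => hij ▸ hτ i, ?_, h⟩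
  rcases h with h | h
  · exact h.1.trans (by norm_num)
  · exact h.1.le
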